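/- Let $\lambda$ be a Young diagram with $N$ boxes, let $m\ge 1$ be an integer, and for a box $b$ let $r(b)$ and $c(b)$ be its row and column numbers, counted from $1$. For pairwise distinct $z_1,\dots,z_N\in\mathbb C$ consider variables $t^b_s\in\mathbb C$ indexed by the boxes $b$ and the integers $1\le s\le r(b)-1$, let $d=\sum_b (r(b)-1)$ be their number, and let $G_\lambda$ be the group of permutations of the variables that preserve the lower index $s$. For a numbering $T$ (a bijection from the boxes to $\{1,\dots,N\}$) put $$\Phi_\lambda=\prod_{i<j}(z_i-z_j)^2\prod_{s}\prod_{\{b,b'\},\,b\ne b'}(t^b_s-t^{b'}_s)^2\prod_{s,b,b'}(t^b_{s+1}-t^{b'}_s)^{-1}\prod_{k,b}(t^b_1-z_k)^{-1},$$ $$\phi_T=\prod_{s,b}(t^b_{s+1}-t^b_s)^{-1}\prod_{b:\,r(b)>1}(t^b_1-z_{T(b)})^{-1},\qquad \omega_T=\frac{1}{(2\pi i)^{d}}\,\Phi_\lambda^m\,\phi_T\,dt,\qquad dt=\prod_{s,b}dt^b_s,$$ where the second product in $\Phi_\lambda$ runs over unordered pairs. For $\epsilon>0$ let $\Gamma_T$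 be the torus on which each $t^b_s$ runs anticlockwise over the circle $|t^b_s-z_{T(b)}|=\epsilon s$, oriented by the same ordering of the variables as in $dt$. Let $\sigma_T=\sum_{g\in G_\lambda}(-1)^g g_*(\Gamma_T)$ and, for all sufficiently small $\epsilon$, $\psi_{T,T'}(z)=\int_{\sigma_T}\omega_{T'}$. Let $T$ be the standard tableau that maps the $k$th box, counted from left to right and top to bottom, to $k$. Then: 1. For all pairwise distinct $z_1,\dots,z_N$ the integral $\int_{\sigma_T}\omega_T$ does not depend on $\epsilon$ for $\epsilon>0$ small enough, so that $\psi_{T,T}(z)$ is well defined. 2. The function $\psi_{T,T}$ is not identically zero on $\{z\in\mathbb C^N: z_i\neq z_j\text{ for }i\ne j\}$. 3. There is an integer $C\neq 0$, depending only on $\lambda$ and $m$, such that $$\psi_{T,T}(z)\sim C\prod_{b\in\lambda}z_{T(b)}^{\,m(T(b)-1+c(b)-r(b))}\qquad\text{for }0\ll|z_1|\ll|z_2|\ll\cdots\ll|z_N|.$$ That is, writing $M(z)$ for the monomial on the right without the factor $C$, for every $\eta>0$ there is $\delta>0$ such that $|\psi_{T,T}(z)-C\,M(z)|\le\eta\,|M(z)|$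 for all $z\in(\mathbb C\setminus\{0\})^N$ with $|z_i|\le\delta\,|z_{i+1}|$ for $i=1,\dots,N-1$. -/

import Mathlib

open Filter Topology MeasureTheory

noncomputable section

namespace KZ

/-- The boxes of a Young diagram. The underlying pair of naturals counts rows and columns from 0. -/
abbrev Box (lam : YoungDiagram) : Type := {b : ℕ × ℕ // b ∈ lam.cells}

/-- The row number `r(b)`, counted from 1, top to bottom. -/
def row {lam : YoungDiagram} (b : Box lam) : ℕ := b.1.1 + 1

/-- The column number `c(b)`, counted from 1, left to right. -/
def col {lam : YoungDiagram} (b : Box lam) : ℕ := b.1.2 + 1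

/-- `b` is read before `b'`: left to right in each row, rows from top to bottom. -/
def ReadBefore {lam : YoungDiagram} (b b' : Box lam) : Prop :=
  row b < row b' ∨ (row b = row b' ∧ col b < col b')

instance {lam : YoungDiagram} (b b' : Box lam) : Decidable (ReadBefore b b') :=
  inferInstanceAs (Decidable (_ ∨ _))

/-- A numbering: a bijection from the boxes to the `N` labels, the label `k` being represented
by the element `k - 1` of `Fin N`, where `N` is the number of boxes. -/
abbrev Numbering (lam : YoungDiagram) : Type := Box lam ≃ Fin lam.card

/-- The label `T(b)`, an integer between 1 and `N`. -/
def label {lam : YoungDiagram} (T : Numbering lam) (b : Box lam) : ℕ := (T b : ℕ) + 1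

/-- Standard tableaux: numberings that increase from left to right and from top to bottom. -/
def IsStandard {lam : YoungDiagram} (T : Numbering lam) : Prop :=
  (∀ b b' : Box lam, row b = row b' → col b < col b' → label T b < label T b') ∧
  (∀ b b' : Box lam, col b = col b' → row b < row b' → label T b < label T b')

/-- The boxes, as elements of `ℕ × ℕ` with the lexicographic order. -/
def lexCells (lam : YoungDiagram) : Finset (ℕ ×ₗ ℕ) := lam.cells.map toLex.toEmbedding

/-- The numbering that maps the `k`th box, counted from left to right and top to bottom, to `k`. -/
def rowReading (lam : YoungDiagram) : Numbering lam :=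
  (toLex.subtypeEquiv (fun b => by simp [lexCells]) :
      Box lam ≃ {b : ℕ ×ₗ ℕ // b ∈ lexCells lam}).trans
    ((lexCells lam).orderIsoOfFin (Finset.card_map _)).symm.toEquiv

theorem rowReading_lt_iff {lam : YoungDiagram} (b b' : Box lam) :
    label (rowReading lam) b < label (rowReading lam) b' ↔ ReadBefore b b' := by
  have h : rowReading lam b < rowReading lam b' ↔ toLex b.1 < toLex b'.1 := by
    simp only [rowReading, Equiv.trans_apply]
    exact ((lexCells lam).orderIsoOfFin (Finset.card_map _)).symm.lt_iff_lt
  simp only [label, add_lt_add_iff_right, Fin.val_fin_lt, h, Prod.Lex.toLex_lt_toLex,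
    ReadBefore, row, col, add_left_inj]

theorem rowReading_isStandard (lam : YoungDiagram) : IsStandard (rowReading lam) :=
  ⟨fun b b' h h' => (rowReading_lt_iff b b').2 (Or.inr ⟨h, h'⟩),
    fun b b' _ h' => (rowReading_lt_iff b b').2 (Or.inl h')⟩

/-- The indices of the integration variables `t^b_s`, for `b` a box and `1 ≤ s ≤ r(b) - 1`. -/
abbrev Var (lam : YoungDiagram) : Type := Σ b : Box lam, Fin (row b - 1)

/-- The box `b` of the variable `t^b_s`. -/
def box {lam : YoungDiagram} (j : Var lam) : Box lam := j.1

/-- The level `s` of the variable `t^b_s`. -/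
def level {lam : YoungDiagram} (j : Var lam) : ℕ := (j.2 : ℕ) + 1

/-- The master function `Φ_λ`. The products of squares run over unordered pairs. -/
def masterFunction (lam : YoungDiagram) (z : Fin lam.card → ℂ) (t : Var lam → ℂ) : ℂ :=
  (∏ p : Fin lam.card × Fin lam.card with p.1 < p.2, (z p.1 - z p.2) ^ 2) *
  (∏ p : Var lam × Var lam with level p.1 = level p.2 ∧ ReadBefore (box p.1) (box p.2),
    (t p.1 - t p.2) ^ 2) *
  (∏ p : Var lam × Var lam with level p.1 = level p.2 + 1, (t p.1 - t p.2)⁻¹) *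
  (∏ j : Var lam with level j = 1, ∏ k : Fin lam.card, (t j - z k)⁻¹)

/-- The rational function `φ_T`. -/
def phi {lam : YoungDiagram} (T : Numbering lam) (z : Fin lam.card → ℂ) (t : Var lam → ℂ) : ℂ :=
  (∏ p : Var lam × Var lam with level p.1 = level p.2 + 1 ∧ box p.1 = box p.2,
    (t p.1 - t p.2)⁻¹) *
  (∏ j : Var lam with level j = 1, (t j - z (T (box j)))⁻¹)

/-- The coefficient of `dt` in the form `ω_T = (2πi)^(-d) Φ_λ^m φ_T dt`. -/
def omega {lam : YoungDiagram} (m : ℕ) (T : Numbering lam) (z : Fin lam.card → ℂ)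
    (t : Var lam → ℂ) : ℂ :=
  ((2 * (Real.pi : ℂ) * Complex.I) ^ Fintype.card (Var lam))⁻¹ *
    masterFunction lam z t ^ m * phi T z t

/-- The group `G_λ`, the product over `s` of the symmetric groups of the variables of level `s`,
as the group of all permutations of the variables that preserve the level. -/
def levelGroup (lam : YoungDiagram) : Subgroup (Equiv.Perm (Var lam)) where
  carrier := {g | ∀ j, level (g j) = level j}
  mul_mem' := fun {a b} ha hb j => (ha (b j)).trans (hb j)
  one_mem' := fun _ => rfl
  inv_mem' := fun {a} ha j => by
    have h := ha (a⁻¹ j)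
    rw [← Equiv.Perm.mul_apply, mul_inv_cancel, Equiv.Perm.one_apply] at h
    exact h.symm

instance (lam : YoungDiagram) : DecidablePred (· ∈ levelGroup lam) :=
  fun g => inferInstanceAs (Decidable (∀ j, level (g j) = level j))

/-- The integral of the top degree form `f dt` over the parametrised cube
`γ : [0, 2π]^ι → ℂ^ι`, that is, the integral over the cube of the pullback of `f dt` by `γ`. -/
def formIntegral {ι : Type} [Fintype ι] [DecidableEq ι] (f : (ι → ℂ) → ℂ)
    (γ : (ι → ℝ) → (ι → ℂ)) : ℂ :=
  ∫ θ in Set.Icc (0 : ι → ℝ) (fun _ => 2 * Real.pi),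
    f (γ θ) *
      (Matrix.of fun j k : ι => deriv (fun x : ℝ => γ (Function.update θ k x) j) (θ k)).det

/-- The torus `Γ_T`: the variable `t^b_s` runs anticlockwise over the circle of radius `ε s`
around `z_{T(b)}`. -/
def torus {lam : YoungDiagram} (T : Numbering lam) (z : Fin lam.card → ℂ) (ε : ℝ)
    (θ : Var lam → ℝ) (j : Var lam) : ℂ :=
  z (T (box j)) + (ε * level j : ℝ) * Complex.exp (Complex.I * θ j)

/-- The integral of `ω_{T'}` over the cycle `σ_T = ∑_g (-1)^g g_*(Γ_T)`, where the torus `Γ_T`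
is taken with the parameter `ε`. -/
def cycleIntegral {lam : YoungDiagram} (m : ℕ) (T T' : Numbering lam) (z : Fin lam.card → ℂ)
    (ε : ℝ) : ℂ :=
  ∑ g : levelGroup lam, ((Equiv.Perm.sign (g : Equiv.Perm (Var lam)) : ℤ) : ℂ) *
    formIntegral (omega m T' z)
      (fun θ j => torus T z ε θ ((g : Equiv.Perm (Var lam))⁻¹ j))

/-- The function `ψ_{T,T'}`: the value of the integral of `ω_{T'}` over `σ_T` for small `ε`. -/
def psi {lam : YoungDiagram} (m : ℕ) (T T' : Numbering lam) (z : Fin lam.card → ℂ) : ℂ :=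
  limUnder (𝓝[>] (0 : ℝ)) (fun ε => cycleIntegral m T T' z ε)

/-- The monomial `∏_b z_{T(b)}^{m (T(b) - 1 + c(b) - r(b))}`. -/
def leadingMonomial {lam : YoungDiagram} (m : ℕ) (T : Numbering lam)
    (z : Fin lam.card → ℂ) : ℂ :=
  ∏ b : Box lam, z (T b) ^ ((m : ℤ) * ((label T b : ℤ) - 1 + (col b : ℤ) - (row b : ℤ)))

end KZ

end

/-!
Write `w_b = z_{T(b)}`, where `T` is the row reading.

**Torus means.** The permutation of the variables contributes the sign of `g` to the Jacobian, so
the sign in `σ_T` cancels, and `∫_{σ_T} ω_T` is the sum over `g` of the means over `Γ_T` of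
`Φ^m (φ_T ∘ g) ∏ (t^b_s - w_b)` (`cycleIntegral_eq_sum`). By Cauchy's theorem in one variable a
torus mean does not change when the circles about each `w_b` are enlarged, as long as they stay
nested and the discs about different `w_b` stay disjoint (`torusMean_integrand_eq`). This gives the
independence of `ε`, and it allows the circles to be given radii proportional to `|w_b|` when the
points `w_b` are of different orders of magnitude (`psi_eq_sum`).

**The leading term.** On these large tori the points `t^b_0 = w_b`, `t^b_1`, `t^b_2`, … of a box are
all comparable to `w_b`, so in a difference of points of different boxes the point of the box read
last dominates. Replacing all such differences turns the term of `g = 1` into a product over the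
boxes of functions of the variables of one box (`leadTerm_eq`). The term of `g ≠ 1` is of lower
order: the differences in `φ_T ∘ g` may be estimated from below by the sizes of their outer points,
which are permuted by `g`, and one of these estimates is not sharp. Indeed, among the variables of
minimal level moved by the permutation, consider the one whose box `b` is read last; it is replaced
by a variable of a smaller box, while the inner point of the difference remains at the size of `w_b`
(`exists_readBefore`, `permTerm_isLittleO`).

**The constant.** The exponent of `t^b_s` in the leading term of `Φ^m` is
`m ((n_s - n_{s+1}) - (n_{s-1} - n_s))`, where `n_s` is the number of boxes read before `b` in
the rows below the `s`th, and `t^b_s` and `t^b_{s-1}` are linked by `(t^b_s - t^b_{s-1})^{-m-1}`.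
The variables of `b` are integrated out from the outermost one inwards; each integral is a
residue `Res_{x=p} x^a (x - p)^{-m-1} = binom(a, m) p^{a-m}`
(`circleAverage_inv_pow_mul_inv_pow`). The exponents `a` that occur are all negative, because a row
above the one of `b` has at least `c(b)` boxes, whereas only `c(b) - 1` boxes are read before `b` in
the row of `b` (`expo_add_tailExpo_neg`). Hence no binomial coefficient vanishes. The exponents of
`w_b` telescope to `m (T(b) - 1 + c(b) - r(b))` (`expo_add_tailExpo_zero`).

Since the error terms are uniform on the tori, this proves the asymptotics, and the asymptotics on a
geometric progression show that `ψ_{T,T}` is not identically zero.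
-/

open Asymptotics

noncomputable section

namespace KZ

/-! ### Means over tori -/

section TorusMean

variable {ι : Type}

/-- The point with angles `θ` of the torus `∏ⱼ {|tⱼ - cⱼ| = Rⱼ}`. -/
def polyCircleMap (c : ι → ℂ) (R : ι → ℝ) (θ : ι → ℝ) : ι → ℂ :=
  fun j => circleMap (c j) (R j) (θ j)

/-- The mean of `f` over the torus `∏ⱼ {|tⱼ - cⱼ| = Rⱼ}` with respect to the angles. -/
def torusMean [Fintype ι] (c : ι → ℂ) (R : ι → ℝ) (f : (ι → ℂ) → ℂ) : ℂ :=
  ((2 * (Real.pi : ℂ)) ^ Fintype.card ι)⁻¹ *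
    ∫ θ in Set.Icc (0 : ι → ℝ) (fun _ => 2 * Real.pi), f (polyCircleMap c R θ)

theorem continuous_polyCircleMap (c : ι → ℂ) (R : ι → ℝ) : Continuous (polyCircleMap c R) :=
  continuous_pi fun j => (continuous_circleMap _ _).comp (continuous_apply j)

theorem polyCircleMap_update [DecidableEq ι] (c : ι → ℂ) (R : ι → ℝ) (θ : ι → ℝ) (k : ι) (x : ℝ) :
    polyCircleMap c R (Function.update θ k x) =
      Function.update (polyCircleMap c R θ) k (circleMap (c k) (R k) x) := by
  funext j
  by_cases h : j = k
  · subst h; simp [polyCircleMap]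
  · simp [polyCircleMap, h]

theorem volume_restrict_cube [Fintype ι] (a b : ι → ℝ) :
    (volume : Measure (ι → ℝ)).restrict (Set.Icc a b) =
      Measure.pi fun j => (volume : Measure ℝ).restrict (Set.Icc (a j) (b j)) := by
  rw [← Measure.restrict_pi_pi, Set.pi_univ_Icc, volume_pi]

/-- Replacing the `k`th coordinate by an independent copy preserves a product measure, up to the
total mass of the `k`th factor. -/
theorem map_update_pi [Fintype ι] [DecidableEq ι] (ν : ι → Measure ℝ)
    [∀ j, IsFiniteMeasure (ν j)] (k : ι) :
    ((Measure.pi ν).prod (ν k)).map (fun p => Function.update p.1 k p.2) =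
      ν k Set.univ • Measure.pi ν := by
  have hm : Measurable (fun p : (ι → ℝ) × ℝ => Function.update p.1 k p.2) := by
    refine measurable_pi_lambda _ fun j => ?_
    by_cases h : j = k
    · subst h; simpa using measurable_snd
    · simp only [Function.update_of_ne h]
      exact (measurable_pi_apply j).comp measurable_fst
  by_cases h0 : ν k Set.univ = 0
  · have : ν k = 0 := Measure.measure_univ_eq_zero.1 h0
    simp [this]
  have htop : ν k Set.univ ≠ ⊤ := measure_ne_top _ _
  have key : (ν k Set.univ)⁻¹ • ((Measure.pi ν).prod (ν k)).map
      (fun p => Function.update p.1 k p.2) = Measure.pi ν := by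
    symm
    refine Measure.pi_eq fun s hs => ?_
    rw [Measure.smul_apply, Measure.map_apply hm (MeasurableSet.univ_pi hs)]
    have : (fun p : (ι → ℝ) × ℝ => Function.update p.1 k p.2) ⁻¹' Set.pi Set.univ s =
        (Set.pi Set.univ (Function.update s k Set.univ)) ×ˢ s k := by
      ext p
      simp only [Set.mem_preimage, Set.mem_pi, Set.mem_univ, true_implies, Set.mem_prod]
      constructor
      · intro h
        refine ⟨fun j => ?_, by simpa using h k⟩
        by_cases hj : j = k
        · subst hj; simp
        · simpa [hj] using h j
      · rintro ⟨h1, h2⟩ j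
        by_cases hj : j = k
        · subst hj; simpa using h2
        · simpa [hj] using h1 j
    rw [this, Measure.prod_prod, Measure.pi_pi,
      ← Finset.mul_prod_erase Finset.univ _ (Finset.mem_univ k),
      ← Finset.mul_prod_erase Finset.univ (fun i => ν i (s i)) (Finset.mem_univ k)]
    have : ∏ x ∈ Finset.univ.erase k, ν x (Function.update s k Set.univ x) =
        ∏ x ∈ Finset.univ.erase k, ν x (s x) :=
      Finset.prod_congr rfl fun x hx => by
        rw [Function.update_of_ne (Finset.ne_of_mem_erase hx)]
    rw [this, Function.update_self, smul_eq_mul]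
    rw [mul_assoc, ← mul_assoc, ENNReal.inv_mul_cancel h0 htop, one_mul, mul_comm]
  rw [← key, smul_smul, ENNReal.mul_inv_cancel h0 htop, one_smul, key]

/-- Fubini for a single angle, without separating it from the others. -/
theorem torusMean_eq_circleAverage [Fintype ι] [DecidableEq ι] (c : ι → ℂ) (R : ι → ℝ)
    (f : (ι → ℂ) → ℂ) (k : ι)
    (hf : Continuous fun θ => f (polyCircleMap c R θ)) :
    torusMean c R f = ((2 * (Real.pi : ℂ)) ^ Fintype.card ι)⁻¹ *
      ∫ θ in Set.Icc (0 : ι → ℝ) (fun _ => 2 * Real.pi),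
        Real.circleAverage (fun x => f (Function.update (polyCircleMap c R θ) k x))
          (c k) (R k) := by
  unfold torusMean
  congr 1
  rw [volume_restrict_cube]
  set ν : ι → Measure ℝ := fun j => volume.restrict (Set.Icc ((0 : ι → ℝ) j) (2 * Real.pi)) with hν
  have hpos : (0 : ℝ) ≤ 2 * Real.pi := by positivity
  have hmass : ν k Set.univ = ENNReal.ofReal (2 * Real.pi) := by
    simp [hν]
  have hmap := map_update_pi ν k
  set F : (ι → ℝ) → ℂ := fun θ => f (polyCircleMap c R θ) with hF
  have hu : Continuous (fun p : (ι → ℝ) × ℝ => Function.update p.1 k p.2) :=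
    continuous_fst.update k continuous_snd
  have hprod : (Measure.pi ν).prod (ν k) =
      (volume.prod volume).restrict (Set.Icc (0 : ι → ℝ) (fun _ => 2 * Real.pi) ×ˢ
        Set.Icc ((0 : ι → ℝ) k) (2 * Real.pi)) := by
    rw [← Measure.prod_restrict, volume_restrict_cube]
  have hint : Integrable (fun p : (ι → ℝ) × ℝ => F (Function.update p.1 k p.2))
      ((Measure.pi ν).prod (ν k)) := by
    rw [hprod]
    exact ((hf.comp hu).continuousOn).integrableOn_compact (isCompact_Icc.prod isCompact_Icc)
  have h1 : ∫ θ, F θ ∂(ν k Set.univ • Measure.pi ν) =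
      ∫ θ, ∫ x, F (Function.update θ k x) ∂(ν k) ∂(Measure.pi ν) := by
    rw [← hmap, integral_map hu.measurable.aemeasurable hf.aestronglyMeasurable,
      integral_prod _ hint]
  rw [integral_smul_measure, hmass, ENNReal.toReal_ofReal hpos] at h1
  have h2 : ∫ θ, F θ ∂(Measure.pi ν) = (2 * Real.pi)⁻¹ •
      ∫ θ, ∫ x, F (Function.update θ k x) ∂(ν k) ∂(Measure.pi ν) := by
    rw [← h1, smul_smul, inv_mul_cancel₀ (by positivity), one_smul]
  rw [h2, ← integral_smul]
  refine integral_congr_ae (Eventually.of_forall fun θ => ?_)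
  simp only [Real.circleAverage]
  rw [intervalIntegral.integral_of_le hpos, ← integral_Icc_eq_integral_Ioc]
  simp only [hF, polyCircleMap_update, hν, Pi.zero_apply]

/-- Two torus means agree as soon as their averages over one of the variables agree. -/
theorem torusMean_congr_circleAverage [Fintype ι] [DecidableEq ι] {c : ι → ℂ} {R R' : ι → ℝ}
    {f g : (ι → ℂ) → ℂ} (k : ι)
    (hf : Continuous fun θ => f (polyCircleMap c R θ))
    (hg : Continuous fun θ => g (polyCircleMap c R' θ))
    (hR : ∀ j, j ≠ k → R j = R' j)
    (h : ∀ θ, Real.circleAverage (fun x => f (Function.update (polyCircleMap c R θ) k x))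
        (c k) (R k) =
      Real.circleAverage (fun x => g (Function.update (polyCircleMap c R θ) k x)) (c k) (R' k)) :
    torusMean c R f = torusMean c R' g := by
  rw [torusMean_eq_circleAverage c R f k hf, torusMean_eq_circleAverage c R' g k hg]
  congr 1
  refine integral_congr_ae (Eventually.of_forall fun θ => ?_)
  simp only [h θ]
  congr 1
  funext x
  congr 1
  funext j
  by_cases hj : j = k
  · subst hj; simp
  · simp [hj, polyCircleMap, hR j hj]

theorem integrable_cube [Fintype ι] {F : (ι → ℝ) → ℂ} (hF : Continuous F) :
    IntegrableOn F (Set.Icc (0 : ι → ℝ) (fun _ => 2 * Real.pi)) :=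
  hF.continuousOn.integrableOn_compact isCompact_Icc

theorem volume_cube [Fintype ι] :
    (volume (Set.Icc (0 : ι → ℝ) (fun _ => 2 * Real.pi))).toReal =
      (2 * Real.pi) ^ Fintype.card ι := by
  rw [Real.volume_Icc_pi_toReal (fun _ => by positivity)]
  simp

theorem torusMean_const [Fintype ι] (c : ι → ℂ) (R : ι → ℝ) (a : ℂ) :
    torusMean c R (fun _ => a) = a := by
  unfold torusMean
  rw [setIntegral_const, measureReal_def, volume_cube, Complex.real_smul]
  push_cast
  rw [← mul_assoc, inv_mul_cancel₀, one_mul]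
  exact pow_ne_zero _ (mul_ne_zero two_ne_zero (Complex.ofReal_ne_zero.2 Real.pi_ne_zero))

theorem torusMean_congr [Fintype ι] {c : ι → ℂ} {R : ι → ℝ} {f g : (ι → ℂ) → ℂ}
    (h : ∀ θ, f (polyCircleMap c R θ) = g (polyCircleMap c R θ)) :
    torusMean c R f = torusMean c R g := by
  unfold torusMean
  simp only [h]

theorem torusMean_const_mul [Fintype ι] (c : ι → ℂ) (R : ι → ℝ) (a : ℂ)
    (f : (ι → ℂ) → ℂ) : torusMean c R (fun t => a * f t) = a * torusMean c R f := by
  unfold torusMean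
  rw [integral_const_mul]
  ring

theorem torusMean_sub [Fintype ι] (c : ι → ℂ) (R : ι → ℝ) {f g : (ι → ℂ) → ℂ}
    (hf : Continuous fun θ => f (polyCircleMap c R θ))
    (hg : Continuous fun θ => g (polyCircleMap c R θ)) :
    torusMean c R (fun t => f t - g t) = torusMean c R f - torusMean c R g := by
  unfold torusMean
  rw [integral_sub (integrable_cube hf) (integrable_cube hg), mul_sub]

theorem norm_torusMean_le [Fintype ι] (c : ι → ℂ) (R : ι → ℝ) {f : (ι → ℂ) → ℂ} {K : ℝ}
    (h : ∀ θ, ‖f (polyCircleMap c R θ)‖ ≤ K) : ‖torusMean c R f‖ ≤ K := by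
  unfold torusMean
  have h1 := norm_setIntegral_le_of_norm_le_const
    (μ := (volume : Measure (ι → ℝ))) (s := Set.Icc (0 : ι → ℝ) (fun _ => 2 * Real.pi))
    (isCompact_Icc.measure_lt_top) (fun θ _ => h θ)
  rw [measureReal_def, volume_cube] at h1
  rw [norm_mul, norm_inv, norm_pow, norm_mul, Complex.norm_real, Complex.norm_two,
    Real.norm_of_nonneg Real.pi_pos.le, inv_mul_le_iff₀ (by positivity), mul_comm _ K]
  exact h1

theorem circleAverage_eq_of_differentiableAt_annulus {f : ℂ → ℂ} {c : ℂ} {r R : ℝ} (hr : 0 < r)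
    (hrR : r ≤ R) (hf : ∀ x, r ≤ ‖x - c‖ → ‖x - c‖ ≤ R → DifferentiableAt ℂ f x) :
    Real.circleAverage f c r = Real.circleAverage f c R := by
  rw [Real.circleAverage_eq_circleIntegral hr.ne',
    Real.circleAverage_eq_circleIntegral (hr.trans_le hrR).ne']
  congr 1
  refine (Complex.circleIntegral_sub_center_inv_smul_eq_of_differentiable_on_annulus_off_countable
    hr hrR Set.countable_empty ?_ ?_).symm
  · intro x hx
    refine (hf x ?_ ?_).continuousAt.continuousWithinAt
    · simpa [dist_eq_norm] using hx.2
    · simpa [dist_eq_norm] using hx.1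
  · intro x hx
    refine hf x ?_ ?_
    · have := hx.1.2
      simp only [Metric.mem_closedBall, dist_eq_norm, not_le] at this
      exact this.le
    · have := hx.1.1
      simp only [Metric.mem_ball, dist_eq_norm] at this
      exact this.le

theorem continuous_comp_polyCircleMap {c : ι → ℂ} {R : ι → ℝ} {f : (ι → ℂ) → ℂ}
    (hf : ∀ t, (∀ j, ‖t j - c j‖ = |R j|) → ContinuousAt f t) :
    Continuous fun θ => f (polyCircleMap c R θ) := by
  refine continuous_iff_continuousAt.2 fun θ => ?_
  refine ContinuousAt.comp (hf _ fun j => ?_) (continuous_polyCircleMap c R).continuousAt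
  simp [polyCircleMap, circleMap]

/-- A torus mean does not change when the radii grow, provided that the function is holomorphic
on the product of annuli swept by the tori. -/
theorem torusMean_eq_of_differentiableAt [Fintype ι] [DecidableEq ι] {c : ι → ℂ} {R R' : ι → ℝ}
    (hR : ∀ j, 0 < R j) (hRR' : ∀ j, R j ≤ R' j) {f : (ι → ℂ) → ℂ}
    (hf : ∀ t, (∀ j, R j ≤ ‖t j - c j‖) → (∀ j, ‖t j - c j‖ ≤ R' j) → DifferentiableAt ℂ f t) :
    torusMean c R f = torusMean c R' f := by
  -- the radii are enlarged one at a time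
  have key : ∀ S : Finset ι, torusMean c R f = torusMean c (S.piecewise R' R) f := by
    intro S
    induction S using Finset.induction_on with
    | empty => simp
    | insert k S hk ih =>
      rw [ih]
      have hlow : ∀ (S : Finset ι) j, R j ≤ S.piecewise R' R j := fun S j => by
        by_cases h : j ∈ S <;> simp [h, hRR' j]
      have hupp : ∀ (S : Finset ι) j, S.piecewise R' R j ≤ R' j := fun S j => by
        by_cases h : j ∈ S <;> simp [h, hRR' j]
      have hcont : ∀ S : Finset ι,
          Continuous fun θ => f (polyCircleMap c (S.piecewise R' R) θ) := by
        intro S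
        refine continuous_comp_polyCircleMap fun t ht =>
          (hf t (fun j => ?_) fun j => ?_).continuousAt
        · rw [ht j]; exact (hlow S j).trans (le_abs_self _)
        · rw [ht j, abs_of_pos ((hR j).trans_le (hlow S j))]; exact hupp S j
      refine torusMean_congr_circleAverage k (hcont S) (hcont _) (fun j hj => ?_) fun θ => ?_
      · simp [Finset.piecewise, hj]
      · have h1 : S.piecewise R' R k = R k := by simp [hk]
        have h2 : (insert k S).piecewise R' R k = R' k := by simp
        rw [h1, h2]
        refine circleAverage_eq_of_differentiableAt_annulus (hR k) (hRR' k) fun x hx hx' => ?_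
        have hd : DifferentiableAt ℂ f
            (Function.update (polyCircleMap c (S.piecewise R' R) θ) k x) := by
          have hn : ∀ j, ‖polyCircleMap c (S.piecewise R' R) θ j - c j‖ = S.piecewise R' R j := by
            intro j
            simp [polyCircleMap, circleMap, abs_of_pos ((hR j).trans_le (hlow S j))]
          refine hf _ (fun j => ?_) fun j => ?_
          · by_cases hj : j = k
            · subst hj; simpa using hx
            · rw [Function.update_of_ne hj, hn]; exact hlow S j
          · by_cases hj : j = k
            · subst hj; simpa using hx'
            · rw [Function.update_of_ne hj, hn]; exact hupp S j
        exact DifferentiableAt.comp x hd (hasDerivAt_update _ k x).differentiableAt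
  have := key Finset.univ
  simpa using this

end TorusMean

/-! ### Residues of `x⁻ⁿ (x - p)⁻ᵐ` -/

section Residue

variable {w p : ℂ} {R : ℝ}

/-- The recursion satisfied by the residues of `x⁻ⁿ (x - p)⁻ᵐ` at `p`, which is Pascal's rule. -/
theorem eq_of_residue_recursion {J : ℕ → ℕ → ℂ} {q : ℂ} (hn0 : ∀ n, J n 0 = 0) (h01 : J 0 1 = 1)
    (h0m : ∀ m, J 0 (m + 2) = 0)
    (hsol : ∀ n m, J (n + 1) (m + 1) = q * (J n (m + 1) - J (n + 1) m)) (n m : ℕ) :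
    J (n + 1) (m + 1) = (-1) ^ m * ((n + m).choose m : ℂ) * q ^ (n + 1 + m) := by
  induction m generalizing n with
  | zero =>
    induction n with
    | zero => rw [hsol, h01, hn0]; simp
    | succ n ih => rw [hsol, ih, hn0]; simp [pow_succ]; ring
  | succ m ihm =>
    induction n with
    | zero => rw [hsol, h0m, ihm 0]; simp [pow_succ]; ring
    | succ n ih =>
      rw [hsol, ih, ihm (n + 1), show n + 1 + (m + 1) = (n + (m + 1)) + 1 by ring,
        Nat.choose_succ_succ (n + (m + 1)) m, show n + 1 + m = n + (m + 1) by ring]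
      push_cast
      ring

/-- The residue at `p` of `x⁻ⁿ (x - p)⁻ᵐ` as a mean over a circle about `w` which contains `p`
but not `0`. -/
theorem circleAverage_inv_pow_mul_inv_pow (hp : ‖p - w‖ < R) (hR : R < ‖w‖) (n m : ℕ) :
    Real.circleAverage (fun x => (x⁻¹) ^ (n + 1) * ((x - p)⁻¹) ^ (m + 1) * (x - w)) w R =
      (-1) ^ m * ((n + m).choose m : ℂ) * (p⁻¹) ^ (n + 1 + m) := by
  have hR0 : 0 < R := (norm_nonneg _).trans_lt hp
  have hne : ∀ x ∈ Metric.sphere w R, x - p ≠ 0 ∧ x ≠ 0 ∧ x - w ≠ 0 := by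
    intro x hx
    rw [mem_sphere_iff_norm] at hx
    refine ⟨fun h => ?_, fun h => ?_, fun h => ?_⟩
    · rw [sub_eq_zero.1 h] at hx; linarith
    · rw [h, zero_sub, norm_neg] at hx; linarith
    · rw [h, norm_zero] at hx; linarith
  have hp0 : p ≠ 0 := by
    rintro rfl
    rw [zero_sub, norm_neg] at hp; linarith
  set J : ℕ → ℕ → ℂ := fun n m =>
    (2 * Real.pi * Complex.I : ℂ)⁻¹ * ∮ x in C(w, R), (x⁻¹) ^ n * ((x - p)⁻¹) ^ m with hJ
  have hci : ∀ n m, CircleIntegrable (fun x => (x⁻¹) ^ n * ((x - p)⁻¹) ^ m) w R := by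
    intro n m
    refine ContinuousOn.circleIntegrable hR0.le ?_
    refine ContinuousOn.mul (ContinuousOn.pow (continuousOn_id.inv₀ ?_) _)
      (ContinuousOn.pow (ContinuousOn.inv₀ (by fun_prop) ?_) _)
    · exact fun x hx => (hne x hx).2.1
    · exact fun x hx => (hne x hx).1
  have h1 : Real.circleAverage (fun x => (x⁻¹) ^ (n + 1) * ((x - p)⁻¹) ^ (m + 1) * (x - w)) w R =
      J (n + 1) (m + 1) := by
    rw [Real.circleAverage_eq_circleIntegral hR0.ne', smul_eq_mul]
    simp only [hJ]
    congr 1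
    refine circleIntegral.integral_congr hR0.le fun x hx => ?_
    have := (hne x hx).2.2
    simp only [smul_eq_mul]
    field_simp
  rw [h1]
  have hI : (2 * Real.pi * Complex.I : ℂ) ≠ 0 := Complex.two_pi_I_ne_zero
  have hrec : ∀ n m, p * J (n + 1) (m + 1) = J n (m + 1) - J (n + 1) m := by
    intro n m
    simp only [hJ]
    rw [← mul_sub, ← circleIntegral.integral_sub (hci _ _) (hci _ _), mul_left_comm,
      ← circleIntegral.integral_const_mul]
    congr 1
    refine circleIntegral.integral_congr hR0.le fun x hx => ?_
    obtain ⟨h1, h2, -⟩ := hne x hx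
    have h3 : x⁻¹ * x = 1 := inv_mul_cancel₀ h2
    have h4 : (x - p)⁻¹ * (x - p) = 1 := inv_mul_cancel₀ h1
    simp only [pow_succ]
    linear_combination (x⁻¹ ^ n * (x - p)⁻¹ ^ m * (x - p)⁻¹) * h3 -
      (x⁻¹ ^ n * x⁻¹ * (x - p)⁻¹ ^ m) * h4
  have hn0 : ∀ n, J n 0 = 0 := by
    intro n
    simp only [hJ, pow_zero, mul_one]
    rw [DiffContOnCl.circleIntegral_eq_zero hR0.le, mul_zero]
    refine DifferentiableOn.diffContOnCl fun x hx => ?_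
    rw [closure_ball _ hR0.ne', mem_closedBall_iff_norm] at hx
    have : x ≠ 0 := by
      rintro rfl
      rw [zero_sub, norm_neg] at hx; linarith
    exact ((differentiableAt_inv this).pow n).differentiableWithinAt
  have h01 : J 0 1 = 1 := by
    simp only [hJ, pow_zero, one_mul, pow_one]
    rw [circleIntegral.integral_sub_inv_of_mem_ball (mem_ball_iff_norm.2 hp),
      inv_mul_cancel₀ hI]
  have h0m : ∀ m, J 0 (m + 2) = 0 := by
    intro m
    simp only [hJ, pow_zero, one_mul]
    have := circleIntegral.integral_sub_zpow_of_ne (n := -((m : ℤ) + 2)) (by omega) w p R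
    rw [← mul_zero ((2 * Real.pi * Complex.I : ℂ)⁻¹), ← this]
    congr 1
    refine circleIntegral.integral_congr hR0.le fun x hx => ?_
    rw [zpow_neg, inv_pow]
    norm_cast
  -- partial fractions: `1 / (x (x - p)) = (1 / p) (1 / (x - p) - 1 / x)`
  have hsol : ∀ n m, J (n + 1) (m + 1) =
      p⁻¹ * (J n (m + 1) - J (n + 1) m) := by
    intro n m
    rw [← hrec, inv_mul_cancel_left₀ hp0]
  exact eq_of_residue_recursion hn0 h01 h0m hsol n m

end Residue

/-! ### The cycle integral as a sum of torus means -/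

variable {lam : YoungDiagram}

/-- The centre of the circle of the variable `j`. -/
def center (T : Numbering lam) (z : Fin lam.card → ℂ) (j : Var lam) : ℂ := z (T (box j))

/-- The function whose mean over the torus of `T` is, up to sign, the integral of `ω_T` over the
torus permuted by `h⁻¹`: the variables are permuted by `h`, and the factors `t_j - z_{T(b)}`
come from `dt_j = i (t_j - z_{T(b)}) dθ_j`. -/
def integrand (m : ℕ) (T : Numbering lam) (z : Fin lam.card → ℂ) (h : Equiv.Perm (Var lam))
    (t : Var lam → ℂ) : ℂ :=
  masterFunction lam z (t ∘ h) ^ m * phi T z (t ∘ h) * ∏ j, (t j - center T z j)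

theorem torus_eq_polyCircleMap (T : Numbering lam) (z : Fin lam.card → ℂ) (ε : ℝ)
    (θ : Var lam → ℝ) :
    torus T z ε θ = polyCircleMap (center T z) (fun j => ε * level j) θ := by
  funext j
  simp only [torus, polyCircleMap, circleMap, center, mul_comm Complex.I]

theorem det_deriv_torus (T : Numbering lam) (z : Fin lam.card → ℂ) (ε : ℝ)
    (h : Equiv.Perm (Var lam)) (θ : Var lam → ℝ) :
    (Matrix.of fun j k : Var lam =>
        deriv (fun x : ℝ => torus T z ε (Function.update θ k x) (h j)) (θ k)).det =
      (Equiv.Perm.sign h : ℤ) * ∏ j, (Complex.I * (torus T z ε θ j - center T z j)) := by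
  have : (Matrix.of fun j k : Var lam =>
        deriv (fun x : ℝ => torus T z ε (Function.update θ k x) (h j)) (θ k)) =
      (Matrix.diagonal fun j => Complex.I * (torus T z ε θ j - center T z j)).submatrix h id := by
    ext j k
    simp only [Matrix.of_apply, Matrix.submatrix_apply, id_eq, torus_eq_polyCircleMap,
      polyCircleMap_update, Matrix.diagonal_apply]
    by_cases hjk : h j = k
    · subst hjk
      simp only [Function.update_self, if_true]
      rw [show (fun x : ℝ => circleMap (center T z (h j)) (ε * level (h j)) x) =
        circleMap (center T z (h j)) (ε * level (h j)) from rfl, deriv_circleMap]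
      simp only [polyCircleMap, circleMap_sub_center]
      ring
    · simp [hjk]
  rw [this, Matrix.det_permute, Matrix.det_diagonal]

theorem formIntegral_torus (m : ℕ) (T : Numbering lam) (z : Fin lam.card → ℂ) (ε : ℝ)
    (h : Equiv.Perm (Var lam)) :
    formIntegral (omega m T z) (fun θ j => torus T z ε θ (h j)) =
      (Equiv.Perm.sign h : ℤ) *
        torusMean (center T z) (fun j => ε * level j) (integrand m T z h) := by
  unfold formIntegral torusMean
  rw [mul_left_comm, ← integral_const_mul, ← integral_const_mul]
  refine integral_congr_ae (Eventually.of_forall fun θ => ?_)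
  simp only
  rw [det_deriv_torus, ← torus_eq_polyCircleMap, Finset.prod_mul_distrib, Finset.prod_const,
    Finset.card_univ]
  simp only [omega, integrand]
  rw [show (fun j => torus T z ε θ (h j)) = torus T z ε θ ∘ h from rfl, mul_pow _ Complex.I]
  have : Complex.I ^ Fintype.card (Var lam) ≠ 0 := pow_ne_zero _ Complex.I_ne_zero
  rw [mul_inv]
  field_simp

theorem cycleIntegral_eq_sum (m : ℕ) (T : Numbering lam) (z : Fin lam.card → ℂ) (ε : ℝ) :
    cycleIntegral m T T z ε = ∑ g : levelGroup lam,
      torusMean (center T z) (fun j => ε * level j)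
        (integrand m T z (g : Equiv.Perm (Var lam))⁻¹) := by
  unfold cycleIntegral
  refine Finset.sum_congr rfl fun g _ => ?_
  rw [formIntegral_torus, ← mul_assoc, Equiv.Perm.sign_inv]
  rcases Int.units_eq_one_or (Equiv.Perm.sign (g : Equiv.Perm (Var lam))) with h | h <;> simp [h]

/-- `t` avoids the poles of the master function. -/
def NonSingular (z : Fin lam.card → ℂ) (t : Var lam → ℂ) : Prop :=
  (∀ i j, level i = level j + 1 → t i ≠ t j) ∧ ∀ j, level j = 1 → ∀ k, t j ≠ z k

theorem NonSingular.comp {z : Fin lam.card → ℂ} {t : Var lam → ℂ} (ht : NonSingular z t)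
    {h : Equiv.Perm (Var lam)} (hh : h ∈ levelGroup lam) : NonSingular z (t ∘ h) := by
  have hl : ∀ j, level (h j) = level j := hh
  exact ⟨fun i j hij => ht.1 _ _ (by rw [hl, hl, hij]), fun j hj => ht.2 _ (by rw [hl, hj])⟩

theorem differentiableAt_prod {E ι : Type*} [NormedAddCommGroup E] [NormedSpace ℂ E]
    {s : Finset ι} {f : ι → E → ℂ} {x : E} (hf : ∀ i ∈ s, DifferentiableAt ℂ (f i) x) :
    DifferentiableAt ℂ (fun x => ∏ i ∈ s, f i x) x := by
  classical
  exact (HasFDerivAt.finsetProd fun i hi => (hf i hi).hasFDerivAt).differentiableAt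

theorem differentiableAt_integrand (m : ℕ) (T : Numbering lam) {z : Fin lam.card → ℂ}
    {t : Var lam → ℂ} (ht : NonSingular z t) {h : Equiv.Perm (Var lam)} (hh : h ∈ levelGroup lam) :
    DifferentiableAt ℂ (integrand m T z h) t := by
  have hs := ht.comp hh
  have hd : ∀ j, DifferentiableAt ℂ (fun t : Var lam → ℂ => t j) t := fun j => by fun_prop
  unfold integrand masterFunction phi
  simp only [Function.comp_apply]
  refine .mul (.mul (.pow (.mul (.mul (.mul ?_ ?_) ?_) ?_) m) (.mul ?_ ?_)) ?_
  · fun_prop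
  · exact differentiableAt_prod fun p _ => by fun_prop
  · refine differentiableAt_prod fun p hp => DifferentiableAt.inv (by fun_prop) (sub_ne_zero.2 ?_)
    exact hs.1 _ _ (Finset.mem_filter.1 hp).2
  · refine differentiableAt_prod fun j hj => differentiableAt_prod fun k _ =>
      DifferentiableAt.inv (by fun_prop) (sub_ne_zero.2 ?_)
    exact hs.2 _ (Finset.mem_filter.1 hj).2 k
  · refine differentiableAt_prod fun p hp => DifferentiableAt.inv (by fun_prop) (sub_ne_zero.2 ?_)
    exact hs.1 _ _ (Finset.mem_filter.1 hp).2.1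
  · refine differentiableAt_prod fun j hj => DifferentiableAt.inv (by fun_prop) (sub_ne_zero.2 ?_)
    exact hs.2 _ (Finset.mem_filter.1 hj).2 _
  · exact differentiableAt_prod fun p _ => by fun_prop

/-- The numbers `U b` are radii of disjoint closed discs about the points `z_{T(b)}`. -/
def IsSeparated (T : Numbering lam) (z : Fin lam.card → ℂ) (U : Box lam → ℝ) : Prop :=
  (∀ b, 0 < U b) ∧ ∀ b b', b ≠ b' → U b + U b' < ‖z (T b) - z (T b')‖

theorem ne_of_isSeparated {T : Numbering lam} {z : Fin lam.card → ℂ} {U : Box lam → ℝ}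
    (hU : IsSeparated T z U) {b b' : Box lam} (hb : b ≠ b') {x y : ℂ}
    (hx : ‖x - z (T b)‖ ≤ U b) (hy : ‖y - z (T b')‖ ≤ U b') : x ≠ y := by
  rintro rfl
  have := hU.2 b b' hb
  have h := norm_sub_le (x - z (T b')) (x - z (T b))
  rw [show x - z (T b') - (x - z (T b)) = z (T b) - z (T b') by ring] at h
  linarith

theorem nonSingular_of_isSeparated {T : Numbering lam} {z : Fin lam.card → ℂ} {U : Box lam → ℝ}
    (hU : IsSeparated T z U) {t : Var lam → ℂ} (h0 : ∀ j, 0 < ‖t j - center T z j‖)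
    (ht : ∀ j, ‖t j - center T z j‖ ≤ U (box j))
    (hlt : ∀ i j, box i = box j → level i = level j + 1 →
      ‖t j - center T z j‖ < ‖t i - center T z i‖) : NonSingular z t := by
  constructor
  · intro i j hij
    by_cases hb : box i = box j
    · intro h
      have := hlt i j hb hij
      simp [center, hb, h] at this
    · exact ne_of_isSeparated hU hb (ht i) (ht j)
  · intro j _ k
    by_cases hb : box j = T.symm k
    · intro h
      have := h0 j
      simp [center, hb, h] at this
    · refine ne_of_isSeparated hU hb (ht j) ?_
      simpa using (hU.1 _).le

theorem level_pos (j : Var lam) : 0 < level j := Nat.succ_pos _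

theorem level_lt_row (j : Var lam) : level j < row (box j) := by
  have := j.2.2
  unfold level box
  omega

/-- Enlarging the nested circles about each point `z_{T(b)}` does not change the mean. The circles
are enlarged level by level, the outermost ones first, so that they stay nested. -/
theorem torusMean_integrand_eq (m : ℕ) {T : Numbering lam} {z : Fin lam.card → ℂ}
    {U : Box lam → ℝ} (hU : IsSeparated T z U) {u v : Box lam → ℝ} (hu : ∀ b, 0 < u b)
    (huv : ∀ b, u b ≤ v b) (hv : ∀ b, v b * row b ≤ U b)
    {h : Equiv.Perm (Var lam)} (hh : h ∈ levelGroup lam) :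
    torusMean (center T z) (fun j => u (box j) * level j) (integrand m T z h) =
      torusMean (center T z) (fun j => v (box j) * level j) (integrand m T z h) := by
  -- `R n`: the circles of level at least `n` have been enlarged, the others have not
  set R : ℕ → Var lam → ℝ := fun n j => (if n ≤ level j then v (box j) else u (box j)) * level j
    with hR
  have hlev : ∀ j : Var lam, (0 : ℝ) < level j := fun j => by exact_mod_cast level_pos j
  have hstep : ∀ n, torusMean (center T z) (R (n + 1)) (integrand m T z h) =
      torusMean (center T z) (R n) (integrand m T z h) := by
    intro n
    have hpos : ∀ n j, 0 < R n j := by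
      intro n j
      simp only [hR]
      refine mul_pos ?_ (hlev j)
      split_ifs
      · exact (hu _).trans_le (huv _)
      · exact hu _
    have hle : ∀ n j, R n j ≤ v (box j) * level j := by
      intro n j
      simp only [hR]
      refine mul_le_mul_of_nonneg_right ?_ (hlev j).le
      split_ifs
      · exact le_rfl
      · exact huv _
    have hge : ∀ n j, u (box j) * level j ≤ R n j := by
      intro n j
      simp only [hR]
      refine mul_le_mul_of_nonneg_right ?_ (hlev j).le
      split_ifs
      · exact huv _
      · exact le_rfl
    refine torusMean_eq_of_differentiableAt (hpos _) (fun j => ?_) fun t ht1 ht2 =>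
      differentiableAt_integrand m T (nonSingular_of_isSeparated hU ?_ ?_ ?_) hh
    · simp only [hR]
      refine mul_le_mul_of_nonneg_right ?_ (hlev j).le
      split_ifs <;> first | exact le_rfl | exact huv _ | omega
    · exact fun j => (hpos _ j).trans_le (ht1 j)
    · intro j
      refine (ht2 j).trans ((hle _ j).trans (le_trans ?_ (hv _)))
      refine mul_le_mul_of_nonneg_left ?_ ((hu _).trans_le (huv _)).le
      exact_mod_cast (level_lt_row j).le
    · intro i j hb hij
      refine (ht2 j).trans_lt (lt_of_lt_of_le ?_ (ht1 i))
      have hij' : (level i : ℝ) = level j + 1 := by exact_mod_cast hij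
      by_cases hn : n ≤ level j
      · refine (hle n j).trans_lt ?_
        have : R (n + 1) i = v (box i) * level i := by simp only [hR]; rw [if_pos (by omega)]
        rw [this, hb, hij']
        have := (hu (box j)).trans_le (huv (box j))
        linarith
      · have : R n j = u (box j) * level j := by simp only [hR]; rw [if_neg hn]
        rw [this]
        refine lt_of_lt_of_le ?_ (hge (n + 1) i)
        rw [hb, hij']
        have := hu (box j)
        linarith
  have hall : ∀ n, torusMean (center T z) (R n) (integrand m T z h) =
      torusMean (center T z) (R 0) (integrand m T z h) := by
    intro n
    induction n with
    | zero => rfl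
    | succ n ih => rw [hstep, ih]
  have h0 : R 0 = fun j => v (box j) * level j := by simp [hR]
  obtain ⟨N, hN⟩ : ∃ N, ∀ j : Var lam, level j < N :=
    ⟨Finset.univ.sup level + 1, fun j => Nat.lt_succ_of_le (Finset.le_sup (Finset.mem_univ j))⟩
  have h1 : R N = fun j => u (box j) * level j := by
    funext j
    simp only [hR]
    rw [if_neg (not_le.2 (hN j))]
  rw [← h0, ← h1, hall]

theorem eventually_cycleIntegral_eq (m : ℕ) {T : Numbering lam} {z : Fin lam.card → ℂ}
    {U : Box lam → ℝ} (hU : IsSeparated T z U) {u : Box lam → ℝ} (hu : ∀ b, 0 < u b)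
    (huU : ∀ b, u b * row b ≤ U b) :
    ∀ᶠ ε in 𝓝[>] (0 : ℝ), cycleIntegral m T T z ε = ∑ g : levelGroup lam,
      torusMean (center T z) (fun j => u (box j) * level j)
        (integrand m T z (g : Equiv.Perm (Var lam))⁻¹) := by
  have h1 : ∀ᶠ ε in 𝓝[>] (0 : ℝ), ∀ b, ε ≤ u b :=
    eventually_all.2 fun b => eventually_nhdsWithin_of_eventually_nhds (eventually_le_nhds (hu b))
  filter_upwards [h1, self_mem_nhdsWithin] with ε hε hε0
  rw [cycleIntegral_eq_sum]
  refine Finset.sum_congr rfl fun g _ => ?_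
  exact torusMean_integrand_eq m hU (u := fun _ => ε) (fun _ => hε0) hε huU
    ((levelGroup lam).inv_mem g.2)

theorem psi_eq_sum (m : ℕ) {T : Numbering lam} {z : Fin lam.card → ℂ}
    {U : Box lam → ℝ} (hU : IsSeparated T z U) {u : Box lam → ℝ} (hu : ∀ b, 0 < u b)
    (huU : ∀ b, u b * row b ≤ U b) :
    psi m T T z = ∑ g : levelGroup lam,
      torusMean (center T z) (fun j => u (box j) * level j)
        (integrand m T z (g : Equiv.Perm (Var lam))⁻¹) := by
  refine Tendsto.limUnder_eq (tendsto_const_nhds.congr' ?_)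
  filter_upwards [eventually_cycleIntegral_eq m hU hu huU] with ε hε
  exact hε.symm

theorem eventually_cycleIntegral_eq_psi (m : ℕ) (T : Numbering lam) {z : Fin lam.card → ℂ}
    (hz : Function.Injective z) :
    ∀ᶠ ε in 𝓝[>] (0 : ℝ), cycleIntegral m T T z ε = psi m T T z := by
  have h1 : ∀ᶠ r in 𝓝[>] (0 : ℝ), ∀ b b' : Box lam, b ≠ b' → r + r < ‖z (T b) - z (T b')‖ := by
    refine eventually_all.2 fun b => eventually_all.2 fun b' => ?_
    by_cases hb : b = b'
    · simp [hb]
    · have hpos : 0 < ‖z (T b) - z (T b')‖ :=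
        norm_pos_iff.2 (sub_ne_zero.2 fun h => hb (T.injective (hz h)))
      have : Tendsto (fun r : ℝ => r + r) (𝓝[>] 0) (𝓝 (0 + 0)) :=
        (tendsto_id.add tendsto_id).mono_left nhdsWithin_le_nhds
      rw [add_zero] at this
      filter_upwards [this.eventually_lt_const hpos] with r hr _ using hr
  obtain ⟨r, hr, hr0⟩ := (h1.and self_mem_nhdsWithin).exists
  have hr0 : 0 < r := hr0
  have hU : IsSeparated T z fun _ => r := ⟨fun _ => hr0, hr⟩
  have hrow : ∀ b : Box lam, (0 : ℝ) < row b := fun b => by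
    have : 0 < row b := Nat.succ_pos _
    exact_mod_cast this
  have hu : ∀ b : Box lam, 0 < r / row b := fun b => div_pos hr0 (hrow b)
  have huU : ∀ b : Box lam, r / row b * row b ≤ r := fun b => by
    rw [div_mul_cancel₀ _ (hrow b).ne']
  filter_upwards [eventually_cycleIntegral_eq m hU hu huU] with ε hε
  rw [hε, psi_eq_sum m hU hu huU]

/-! ### Counting boxes -/

/-- The number of boxes read before `b` in the rows below the `s`th one. -/
def before (s : ℕ) (b : Box lam) : ℕ := Fintype.card {b' : Box lam // ReadBefore b' b ∧ s < row b'}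

theorem before_eq_add (s : ℕ) (b : Box lam) :
    before s b = before (s + 1) b +
      Fintype.card {b' : Box lam // ReadBefore b' b ∧ row b' = s + 1} := by
  unfold before
  simp only [Fintype.card_subtype]
  rw [← Finset.card_union_of_disjoint]
  · congr 1
    ext b'
    simp only [Finset.mem_filter, Finset.mem_univ, true_and, Finset.mem_union, ← and_or_left]
    refine and_congr_right fun _ => ?_
    omega
  · rw [Finset.disjoint_left]
    intro b' h1 h2
    simp only [Finset.mem_filter, Finset.mem_univ, true_and] at h1 h2
    omega

theorem before_zero_add_one (b : Box lam) : before 0 b + 1 = label (rowReading lam) b := by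
  unfold before label
  rw [add_left_inj]
  have e : {b' : Box lam // ReadBefore b' b ∧ 0 < row b'} ≃
      {i : Fin lam.card // i < rowReading lam b} :=
    (rowReading lam).subtypeEquiv fun b' => by
      rw [← rowReading_lt_iff]
      simp [label, row]
  rw [Fintype.card_congr e, Fintype.card_subtype]
  have : (Finset.univ.filter fun i => i < rowReading lam b) = Finset.Iio (rowReading lam b) := by
    ext; simp
  rw [this, Fin.card_Iio]

/-- Exactly the `c(b) - 1` boxes to the left of `b` are read before `b` in the row of `b`. -/
theorem before_row (b : Box lam) : before (row b - 1) b + 1 = before (row b) b + col b := by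
  have h := before_eq_add (row b - 1) b
  have hr : row b - 1 + 1 = row b := rfl
  rw [hr] at h
  rw [h, add_assoc, add_right_inj]
  have e : {b' : Box lam // ReadBefore b' b ∧ row b' = row b} ≃ Fin (col b - 1) :=
    { toFun := fun b' => ⟨col b'.1 - 1, by
        have h := b'.2
        unfold ReadBefore col at *
        omega⟩
      invFun := fun i => ⟨⟨(b.1.1, i), by
          have hb : (b.1.1, b.1.2) ∈ lam := b.2
          have hi : (i : ℕ) < b.1.2 := i.2
          exact lam.up_left_mem le_rfl hi.le hb⟩, by
        have hi : (i : ℕ) < b.1.2 := i.2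
        refine ⟨Or.inr ⟨rfl, ?_⟩, rfl⟩
        simp only [col]
        omega⟩
      left_inv := fun b' => by
        obtain ⟨⟨⟨r, c⟩, hc⟩, h1, h2⟩ := b'
        simp only [row, add_left_inj] at h2
        subst h2
        rfl
      right_inv := fun i => rfl }
  rw [Fintype.card_congr e, Fintype.card_fin]
  rfl

/-- A row above the row of `b` has at least `c(b)` boxes, all read before `b`. -/
theorem before_add_col_le {s : ℕ} {b : Box lam} (hs : s + 1 < row b) :
    before (s + 1) b + col b ≤ before s b := by
  rw [before_eq_add s b]
  refine Nat.add_le_add_left ?_ _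
  have f : Function.Injective (fun i : Fin (col b) =>
      (⟨⟨(s, (i : ℕ)), by
        have hb : (b.1.1, b.1.2) ∈ lam := b.2
        have hi : (i : ℕ) < b.1.2 + 1 := i.2
        have hs : s + 1 < b.1.1 + 1 := hs
        exact lam.up_left_mem (by omega) (by omega) hb⟩, Or.inl hs, rfl⟩ :
        {b' : Box lam // ReadBefore b' b ∧ row b' = s + 1})) := by
    intro i j hij
    simp only [Subtype.mk.injEq, Prod.mk.injEq, true_and] at hij
    exact Fin.ext hij
  simpa using Fintype.card_le_of_injective _ f

/-! ### The iterated residue of the leading term -/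

/-- The exponent of the variable `t^b_s` in the leading term of `Φ_λ^m`, where `t^b_0` stands
for `z_{T(b)}`. -/
def expo (m : ℕ) (b : Box lam) : ℕ → ℤ
  | 0 => m * (2 * before 0 b - before 1 b)
  | s + 1 => m * (2 * before (s + 1) b - before s b - before (s + 2) b)

/-- The exponent with which the integrals over `t^b_s`, `s > h`, contribute to `t^b_h`. It is the
sum of the exponents of these variables minus `m` for each of them, in closed form. -/
def tailExpo (m : ℕ) (b : Box lam) (h : ℕ) : ℤ :=
  m * (before (h + 1) b + before (row b - 1) b - before h b - before (row b) b -
    ((row b : ℤ) - 1 - h))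

theorem tailExpo_last (m : ℕ) (b : Box lam) : tailExpo m b (row b - 1) = 0 := by
  have hr : row b - 1 + 1 = row b := rfl
  have : ((row b - 1 : ℕ) : ℤ) = row b - 1 := by
    have : 0 < row b := Nat.succ_pos _
    omega
  unfold tailExpo
  rw [hr, this]
  ring

theorem expo_add_tailExpo_succ (m : ℕ) (b : Box lam) (h : ℕ) :
    expo m b (h + 1) + tailExpo m b (h + 1) = tailExpo m b h + m := by
  simp only [expo, tailExpo]
  push_cast
  ring

theorem expo_add_tailExpo_zero (m : ℕ) (b : Box lam) :
    expo m b 0 + tailExpo m b 0 =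
      m * ((label (rowReading lam) b : ℤ) - 1 + (col b : ℤ) - (row b : ℤ)) := by
  have h1 := before_zero_add_one b
  have h2 := before_row b
  simp only [expo, tailExpo, ← h1]
  have h2' : (before (row b - 1) b : ℤ) + 1 = before (row b) b + col b := by exact_mod_cast h2
  rw [show (before (row b - 1) b : ℤ) = before (row b) b + col b - 1 by linarith]
  push_cast
  ring

/-- The exponent of `t^b_s` when it is integrated out is negative, so that the residue does not
vanish. -/
theorem expo_add_tailExpo_neg {m : ℕ} (hm : 0 < m) {b : Box lam} {h : ℕ} (hh : h + 1 < row b) :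
    expo m b (h + 1) + tailExpo m b (h + 1) < 0 := by
  rw [expo_add_tailExpo_succ]
  have h1 := before_add_col_le hh
  have h2 := before_row b
  unfold tailExpo
  have h1' : (before (h + 1) b : ℤ) + col b ≤ before h b := by exact_mod_cast h1
  have h2' : (before (row b - 1) b : ℤ) + 1 = before (row b) b + col b := by exact_mod_cast h2
  have h3 : (h : ℤ) + 2 ≤ row b := by exact_mod_cast hh
  have hm' : (0 : ℤ) < m := by exact_mod_cast hm
  have : (before (h + 1) b : ℤ) + before (row b - 1) b - before h b - before (row b) b -
    ((row b : ℤ) - 1 - h) + 1 < 0 := by linarith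
  nlinarith

/-- The factor contributed by the integral over `t^b_s`: the binomial coefficient `binom(a, m)` for
the exponent `a < 0` with which `t^b_s` is integrated out. -/
def residueFactor (m : ℕ) (b : Box lam) (s : ℕ) : ℤ :=
  (-1) ^ m * (((-(expo m b s + tailExpo m b s) - 1).toNat + m).choose m : ℤ)

theorem residueFactor_ne_zero (m : ℕ) (b : Box lam) (s : ℕ) : residueFactor m b s ≠ 0 := by
  unfold residueFactor
  refine mul_ne_zero (pow_ne_zero _ (by norm_num)) ?_
  exact_mod_cast (Nat.choose_pos (Nat.le_add_left _ _)).ne'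

/-- The values of `t^b_s`, `0 ≤ s < r(b)`, where `t^b_0 = w b`; the value for `s ≥ r(b)` is `0` by
convention. -/
def chain (w : Box lam → ℂ) (t : Var lam → ℂ) (b : Box lam) : ℕ → ℂ
  | 0 => w b
  | s + 1 => if h : s < row b - 1 then t ⟨b, ⟨s, h⟩⟩ else 0

/-- The factor of `t^b_{s+1}` in the leading term of the integrand; its last factor is the one that
comes from `dt`. -/
def chainFactor (m : ℕ) (w : Box lam → ℂ) (t : Var lam → ℂ) (b : Box lam) (s : ℕ) : ℂ :=
  chain w t b (s + 1) ^ expo m b (s + 1) * ((chain w t b (s + 1) - chain w t b s)⁻¹) ^ (m + 1) *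
    (chain w t b (s + 1) - w b)

/-- The contribution of the box `b` to the leading term of the integrand, after the integration
over the variables `t^b_s`, `s > h`. -/
def boxFactor (m : ℕ) (w : Box lam → ℂ) (t : Var lam → ℂ) (b : Box lam) (h : ℕ) : ℂ :=
  (∏ s ∈ Finset.Ico h (row b - 1), (residueFactor m b (s + 1) : ℂ)) *
    (w b ^ expo m b 0 * (∏ s ∈ Finset.range h, chainFactor m w t b s) *
      chain w t b h ^ tailExpo m b h)

theorem chain_update_self (w : Box lam → ℂ) (t : Var lam → ℂ) (b : Box lam) {h : ℕ}
    (hh : h < row b - 1) (x : ℂ) :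
    chain w (Function.update t ⟨b, ⟨h, hh⟩⟩ x) b (h + 1) = x := by
  simp [chain, hh]

theorem chain_update_of_ne (w : Box lam → ℂ) (t : Var lam → ℂ) {b b' : Box lam} {h s : ℕ}
    (hh : h < row b - 1) (x : ℂ) (hne : b' = b → s ≠ h + 1) :
    chain w (Function.update t ⟨b, ⟨h, hh⟩⟩ x) b' s = chain w t b' s := by
  cases s with
  | zero => rfl
  | succ s =>
    simp only [chain]
    split_ifs with hs
    · rw [Function.update_of_ne]
      rintro heq
      have h1 : b' = b := congrArg Sigma.fst heq
      subst h1
      simp only [Sigma.mk.injEq, heq_eq_eq, Fin.mk.injEq, true_and] at heq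
      exact hne rfl (by omega)
    · rfl

theorem chainFactor_update_of_ne (m : ℕ) (w : Box lam → ℂ) (t : Var lam → ℂ) {b b' : Box lam}
    {h s : ℕ} (hh : h < row b - 1) (x : ℂ) (hne : b' = b → s < h) :
    chainFactor m w (Function.update t ⟨b, ⟨h, hh⟩⟩ x) b' s = chainFactor m w t b' s := by
  unfold chainFactor
  rw [chain_update_of_ne w t hh x fun hb => by have := hne hb; omega,
    chain_update_of_ne w t hh x fun hb => by have := hne hb; omega]

theorem boxFactor_update_of_ne (m : ℕ) (w : Box lam → ℂ) (t : Var lam → ℂ) {b b' : Box lam}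
    {h n : ℕ} (hh : h < row b - 1) (x : ℂ) (hne : b' = b → n ≤ h) :
    boxFactor m w (Function.update t ⟨b, ⟨h, hh⟩⟩ x) b' n = boxFactor m w t b' n := by
  unfold boxFactor
  rw [chain_update_of_ne w t hh x fun hb => by have := hne hb; omega]
  congr 2
  congr 1
  refine Finset.prod_congr rfl fun s hs => chainFactor_update_of_ne m w t hh x fun hb => ?_
  exact (Finset.mem_range.1 hs).trans_le (hne hb)

theorem boxFactor_succ_update (m : ℕ) (w : Box lam → ℂ) (t : Var lam → ℂ) {b : Box lam}
    {h : ℕ} (hh : h < row b - 1) {x : ℂ} (hx : x ≠ 0) :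
    boxFactor m w (Function.update t ⟨b, ⟨h, hh⟩⟩ x) b (h + 1) =
      (∏ s ∈ Finset.Ico (h + 1) (row b - 1), (residueFactor m b (s + 1) : ℂ)) *
      (w b ^ expo m b 0 * (∏ s ∈ Finset.range h, chainFactor m w t b s)) *
      (x ^ (expo m b (h + 1) + tailExpo m b (h + 1)) *
        ((x - chain w t b h)⁻¹) ^ (m + 1) * (x - w b)) := by
  unfold boxFactor
  rw [Finset.prod_range_succ, chain_update_self, zpow_add₀ hx]
  have h1 : ∏ s ∈ Finset.range h, chainFactor m w (Function.update t ⟨b, ⟨h, hh⟩⟩ x) b s =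
      ∏ s ∈ Finset.range h, chainFactor m w t b s :=
    Finset.prod_congr rfl fun s hs =>
      chainFactor_update_of_ne m w t hh x fun _ => Finset.mem_range.1 hs
  rw [h1]
  have h2 : chainFactor m w (Function.update t ⟨b, ⟨h, hh⟩⟩ x) b h =
      x ^ expo m b (h + 1) * ((x - chain w t b h)⁻¹) ^ (m + 1) * (x - w b) := by
    unfold chainFactor
    rw [chain_update_self, chain_update_of_ne w t hh x fun _ => by omega]
  rw [h2]
  ring

/-- The integral over `t^b_{h+1}` of the contribution of the box `b` is a residue at `t^b_h`. -/
theorem circleAverage_boxFactor {m : ℕ} (hm : 0 < m) (w : Box lam → ℂ) (t : Var lam → ℂ)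
    {b : Box lam} {h : ℕ} (hh : h < row b - 1) {R : ℝ} (hR : R < ‖w b‖)
    (ht : ‖chain w t b h - w b‖ < R) :
    Real.circleAverage (fun x => boxFactor m w (Function.update t ⟨b, ⟨h, hh⟩⟩ x) b (h + 1))
      (w b) R = boxFactor m w t b h := by
  have hR0 : 0 < R := (norm_nonneg _).trans_lt ht
  have hneg := expo_add_tailExpo_neg hm (b := b) (h := h) (by omega)
  set E := expo m b (h + 1) + tailExpo m b (h + 1) with hE
  set n := (-E - 1).toNat with hn
  have hEn : E = -((n + 1 : ℕ) : ℤ) := by push_cast; omega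
  set A := (∏ s ∈ Finset.Ico (h + 1) (row b - 1), (residueFactor m b (s + 1) : ℂ)) *
      (w b ^ expo m b 0 * (∏ s ∈ Finset.range h, chainFactor m w t b s)) with hA
  have hcongr : Set.EqOn
      (fun x => boxFactor m w (Function.update t ⟨b, ⟨h, hh⟩⟩ x) b (h + 1))
      (fun x => A • ((x⁻¹) ^ (n + 1) * ((x - chain w t b h)⁻¹) ^ (m + 1) * (x - w b)))
      (Metric.sphere (w b) |R|) := by
    intro x hx
    rw [mem_sphere_iff_norm, abs_of_pos hR0] at hx
    have hx0 : x ≠ 0 := by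
      rintro rfl
      rw [zero_sub, norm_neg] at hx
      linarith
    simp only
    rw [boxFactor_succ_update m w t hh hx0, ← hA, ← hE, hEn, zpow_neg, zpow_natCast,
      inv_pow x, smul_eq_mul]
  rw [Real.circleAverage_congr_sphere hcongr, Real.circleAverage_fun_smul,
    circleAverage_inv_pow_mul_inv_pow ht hR, smul_eq_mul, hA]
  unfold boxFactor
  rw [Finset.prod_eq_prod_Ico_succ_bot hh]
  have hp0 : chain w t b h ≠ 0 := by
    intro h0
    rw [h0, zero_sub, norm_neg] at ht
    linarith
  have htail : tailExpo m b h = -((n + 1 + m : ℕ) : ℤ) := by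
    have := expo_add_tailExpo_succ m b h
    rw [← hE, hEn] at this
    push_cast at this ⊢
    linarith
  rw [htail, zpow_neg, zpow_natCast, ← inv_pow]
  have hres : (residueFactor m b (h + 1) : ℂ) = (-1) ^ m * ((n + m).choose m : ℂ) := by
    unfold residueFactor
    rw [← hE, ← hn]
    push_cast
    rfl
  rw [hres]
  ring

theorem chain_sub_eq (w : Box lam → ℂ) (u : Box lam → ℝ) (θ : Var lam → ℝ) (b : Box lam) {s : ℕ}
    (hs : s < row b) :
    ‖chain w (polyCircleMap (fun j => w (box j)) (fun j => u (box j) * level j) θ) b s - w b‖ =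
      |u b| * s := by
  cases s with
  | zero => simp [chain]
  | succ s =>
    have hs' : s < row b - 1 := by omega
    simp only [chain, dif_pos hs', polyCircleMap, circleMap, box, level]
    simp
    left
    exact_mod_cast abs_of_nonneg (by positivity : (0 : ℝ) ≤ (s : ℝ) + 1)

theorem continuous_chain (w : Box lam → ℂ) (c : Var lam → ℂ) (R : Var lam → ℝ) (b : Box lam)
    (s : ℕ) : Continuous fun θ => chain w (polyCircleMap c R θ) b s := by
  cases s with
  | zero => exact continuous_const
  | succ s =>
    simp only [chain]
    split_ifs with h
    · exact (continuous_apply _).comp (continuous_polyCircleMap c R)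
    · exact continuous_const

theorem continuous_boxFactor (m : ℕ) {w : Box lam → ℂ} {u : Box lam → ℝ} (hu : ∀ b, 0 < u b)
    (huw : ∀ b, u b * row b < ‖w b‖) (b : Box lam) {h : ℕ} (hh : h < row b) :
    Continuous fun θ =>
      boxFactor m w (polyCircleMap (fun j => w (box j)) (fun j => u (box j) * level j) θ) b h := by
  have hne : ∀ s < row b, ∀ θ,
      chain w (polyCircleMap (fun j => w (box j)) (fun j => u (box j) * level j) θ) b s ≠ 0 := by
    intro s hs θ h0
    have h1 := chain_sub_eq w u θ b hs
    rw [h0, zero_sub, norm_neg, abs_of_pos (hu b)] at h1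
    have h2 := huw b
    rw [h1] at h2
    have h3 : (s : ℝ) < row b := by exact_mod_cast hs
    have := mul_lt_mul_of_pos_left h3 (hu b)
    linarith
  have hne2 : ∀ s, s + 1 < row b → ∀ θ,
      chain w (polyCircleMap (fun j => w (box j)) (fun j => u (box j) * level j) θ) b (s + 1) -
      chain w (polyCircleMap (fun j => w (box j)) (fun j => u (box j) * level j) θ) b s ≠ 0 := by
    intro s hs θ h0
    have h1 := chain_sub_eq w u θ b hs
    rw [sub_eq_zero.1 h0, chain_sub_eq w u θ b (by omega : s < row b), abs_of_pos (hu b)] at h1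
    have := hu b
    push_cast at h1
    linarith
  unfold boxFactor
  refine continuous_const.mul (Continuous.mul (continuous_const.mul ?_) ?_)
  · refine continuous_finsetProd _ fun s hs => ?_
    have hs' : s + 1 < row b := by have := Finset.mem_range.1 hs; omega
    refine Continuous.mul (Continuous.mul ?_ (Continuous.pow (Continuous.inv₀ ?_ ?_) _)) ?_
    · exact (continuous_chain _ _ _ _ _).zpow₀ _ fun θ => Or.inl (hne _ hs' θ)
    · exact (continuous_chain _ _ _ _ _).sub (continuous_chain _ _ _ _ _)
    · exact hne2 s hs'
    · exact (continuous_chain _ _ _ _ _).sub continuous_const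
  · exact (continuous_chain _ _ _ _ _).zpow₀ _ fun θ => Or.inl (hne _ hh θ)

/-- The number of variables of `b` that remain drops by one when the outermost of them is integrated
out. -/
theorem torusMean_prod_boxFactor_update {m : ℕ} (hm : 0 < m) {w : Box lam → ℂ} {u : Box lam → ℝ}
    (hu : ∀ b, 0 < u b) (huw : ∀ b, u b * row b < ‖w b‖) (H : Box lam → ℕ)
    (hH : ∀ b, H b < row b) {b : Box lam} {h : ℕ} (hh : H b = h + 1) :
    torusMean (fun j => w (box j)) (fun j => u (box j) * level j)
        (fun t => ∏ b, boxFactor m w t b (H b)) =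
      torusMean (fun j => w (box j)) (fun j => u (box j) * level j)
        (fun t => ∏ b', boxFactor m w t b' (Function.update H b h b')) := by
  have hhr : h < row b - 1 := by have := hH b; omega
  set H' := Function.update H b h with hH'
  have hH'r : ∀ b', H' b' < row b' := by
    intro b'
    by_cases hi : b' = b
    · subst hi; simp only [hH', Function.update_self]; omega
    · simpa [hH', hi] using hH b'
  have hcont : ∀ H : Box lam → ℕ, (∀ b, H b < row b) → Continuous fun θ =>
      ∏ b, boxFactor m w (polyCircleMap (fun j => w (box j))
        (fun j => u (box j) * level j) θ) b (H b) :=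
    fun H hH => continuous_finsetProd _ fun b _ => continuous_boxFactor m hu huw b (hH b)
  refine torusMean_congr_circleAverage ⟨b, ⟨h, hhr⟩⟩ (hcont H hH) (hcont H' hH'r)
    (fun _ _ => rfl) fun θ => ?_
  have hR : u b * (h + 1 : ℕ) < ‖w b‖ := by
    refine lt_of_le_of_lt (mul_le_mul_of_nonneg_left ?_ (hu b).le) (huw b)
    exact Nat.cast_le.2 (by omega)
  have hch : ‖chain w (polyCircleMap (fun j => w (box j)) (fun j => u (box j) * level j) θ) b h -
      w b‖ < u b * (h + 1 : ℕ) := by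
    rw [chain_sub_eq w u θ b (by omega : h < row b), abs_of_pos (hu b)]
    exact mul_lt_mul_of_pos_left (Nat.cast_lt.2 (Nat.lt_succ_self h)) (hu b)
  generalize polyCircleMap (fun j => w (box j)) (fun j => u (box j) * level j) θ = t at hch ⊢
  have hP : ∀ x, ∏ b' ∈ Finset.univ.erase b,
      boxFactor m w (Function.update t ⟨b, ⟨h, hhr⟩⟩ x) b' (H b') =
        ∏ b' ∈ Finset.univ.erase b, boxFactor m w t b' (H b') := fun x =>
    Finset.prod_congr rfl fun b' hb' =>
      boxFactor_update_of_ne m w t hhr x fun hbb => absurd hbb (Finset.ne_of_mem_erase hb')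
  have hP' : ∀ x, ∏ b' ∈ Finset.univ.erase b,
      boxFactor m w (Function.update t ⟨b, ⟨h, hhr⟩⟩ x) b' (H' b') =
        ∏ b' ∈ Finset.univ.erase b, boxFactor m w t b' (H b') := fun x =>
    Finset.prod_congr rfl fun b' hb' => by
      have hbb := Finset.ne_of_mem_erase hb'
      rw [hH', Function.update_of_ne hbb]
      exact boxFactor_update_of_ne m w t hhr x fun h => absurd h hbb
  generalize ∏ b' ∈ Finset.univ.erase b, boxFactor m w t b' (H b') = P at hP hP'
  have h1 : (fun x => ∏ b', boxFactor m w (Function.update t ⟨b, ⟨h, hhr⟩⟩ x) b' (H b')) =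
      fun x => P • boxFactor m w (Function.update t ⟨b, ⟨h, hhr⟩⟩ x) b (h + 1) := by
    funext x
    rw [← Finset.mul_prod_erase _ _ (Finset.mem_univ b), hP, hh, smul_eq_mul, mul_comm]
  have h2 : (fun x => ∏ b', boxFactor m w (Function.update t ⟨b, ⟨h, hhr⟩⟩ x) b' (H' b')) =
      fun _ => P • boxFactor m w t b h := by
    funext x
    rw [← Finset.mul_prod_erase _ _ (Finset.mem_univ b), hP', hH', Function.update_self,
      boxFactor_update_of_ne m w t hhr x fun _ => le_rfl, smul_eq_mul, mul_comm]
  rw [h1, h2, Real.circleAverage_fun_smul, Real.circleAverage_const]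
  exact congrArg _ (circleAverage_boxFactor hm w t hhr hR hch)

/-- The variables are integrated out one at a time, the outermost one of some box first; `H b` is
the number of remaining variables of the box `b`. -/
theorem torusMean_prod_boxFactor {m : ℕ} (hm : 0 < m) {w : Box lam → ℂ} {u : Box lam → ℝ}
    (hu : ∀ b, 0 < u b) (huw : ∀ b, u b * row b < ‖w b‖) (H : Box lam → ℕ)
    (hH : ∀ b, H b < row b) :
    torusMean (fun j => w (box j)) (fun j => u (box j) * level j)
        (fun t => ∏ b, boxFactor m w t b (H b)) =
      ∏ b : Box lam, ((∏ s ∈ Finset.range (row b - 1), (residueFactor m b (s + 1) : ℂ)) *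
        w b ^ (expo m b 0 + tailExpo m b 0)) := by
  induction hN : ∑ b, H b using Nat.strong_induction_on generalizing H with
  | _ N ih =>
    by_cases h0 : ∀ b, H b = 0
    · have : (fun t => ∏ b, boxFactor m w t b (H b)) = fun _ =>
          ∏ b : Box lam, ((∏ s ∈ Finset.range (row b - 1), (residueFactor m b (s + 1) : ℂ)) *
            w b ^ (expo m b 0 + tailExpo m b 0)) := by
        funext t
        refine Finset.prod_congr rfl fun b _ => ?_
        have hw : w b ≠ 0 := by
          intro h
          have := huw b
          rw [h, norm_zero] at this
          have h1 := hu b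
          have h2 : (0 : ℝ) ≤ row b := Nat.cast_nonneg _
          nlinarith
        rw [h0 b, boxFactor, zpow_add₀ hw]
        simp [chain]
      rw [this, torusMean_const]
    · push Not at h0
      obtain ⟨b, hb⟩ := h0
      obtain ⟨h, hh⟩ := Nat.exists_eq_succ_of_ne_zero hb
      rw [torusMean_prod_boxFactor_update hm hu huw H hH hh]
      refine ih _ ?_ _ (fun b' => ?_) rfl
      · rw [← hN]
        refine Finset.sum_lt_sum (fun i _ => ?_) ⟨b, Finset.mem_univ _, by simp [hh]⟩
        by_cases hi : i = b
        · subst hi; simp [hh]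
        · simp [hi]
      · by_cases hi : b' = b
        · subst hi
          have := hH b'
          rw [Function.update_self]
          omega
        · simpa [hi] using hH b'

/-! ### The master function in terms of points -/

theorem ReadBefore.asymm {b b' : Box lam} (h : ReadBefore b b') : ¬ ReadBefore b' b := by
  unfold ReadBefore at *
  omega

theorem ReadBefore.ne {b b' : Box lam} (h : ReadBefore b b') : b ≠ b' := by
  rintro rfl
  exact h.asymm h

theorem readBefore_or_of_ne {b b' : Box lam} (h : b ≠ b') : ReadBefore b b' ∨ ReadBefore b' b := by
  rw [← rowReading_lt_iff, ← rowReading_lt_iff]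
  refine lt_or_gt_of_ne fun h' => h ?_
  simp only [label, add_left_inj] at h'
  exact (rowReading lam).injective (Fin.ext h')

/-- The points `z_{T(b)}` and the variables `t^b_s` together; a point `z_{T(b)}` is regarded as
the variable `t^b_0` of level `0`. -/
abbrev Pt (lam : YoungDiagram) : Type := Box lam ⊕ Var lam

/-- The box of a point. -/
def ptBox : Pt lam → Box lam := Sum.elim id box

/-- The level of a point. -/
def ptLevel : Pt lam → ℕ := Sum.elim (fun _ => 0) level

/-- The position of a point, where `w b` is the position of `t^b_0`. -/
def ptVal (w : Box lam → ℂ) (t : Var lam → ℂ) : Pt lam → ℂ := Sum.elim w t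

@[simp] theorem ptBox_inl (b : Box lam) : ptBox (Sum.inl b : Pt lam) = b := rfl
@[simp] theorem ptBox_inr (j : Var lam) : ptBox (Sum.inr j : Pt lam) = box j := rfl
@[simp] theorem ptLevel_inl (b : Box lam) : ptLevel (Sum.inl b : Pt lam) = 0 := rfl
@[simp] theorem ptLevel_inr (j : Var lam) : ptLevel (Sum.inr j : Pt lam) = level j := rfl
@[simp] theorem ptVal_inl (w : Box lam → ℂ) (t : Var lam → ℂ) (b : Box lam) :
    ptVal w t (Sum.inl b) = w b := rfl
@[simp] theorem ptVal_inr (w : Box lam → ℂ) (t : Var lam → ℂ) (j : Var lam) :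
    ptVal w t (Sum.inr j) = t j := rfl

theorem level_ne_zero (j : Var lam) : level j ≠ 0 := (level_pos j).ne'

theorem var_ext {i j : Var lam} (hb : box i = box j) (hl : level i = level j) : i = j := by
  obtain ⟨b, s, hs⟩ := i
  obtain ⟨b', s', hs'⟩ := j
  simp only [box] at hb
  subst hb
  simp only [level, add_left_inj] at hl
  subst hl
  rfl

theorem pt_ext {p q : Pt lam} (hb : ptBox p = ptBox q) (hl : ptLevel p = ptLevel q) : p = q := by
  rcases p with b | i <;> rcases q with b' | j
  · exact congrArg _ hb
  · exact absurd hl.symm (level_ne_zero j)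
  · exact absurd hl (level_ne_zero i)
  · exact congrArg _ (var_ext hb hl)

theorem exists_pt (b : Box lam) {s : ℕ} (hs : s < row b) :
    ∃ p : Pt lam, ptBox p = b ∧ ptLevel p = s := by
  cases s with
  | zero => exact ⟨Sum.inl b, rfl, rfl⟩
  | succ s => exact ⟨Sum.inr ⟨b, ⟨s, by omega⟩⟩, rfl, rfl⟩

theorem ptLevel_lt_row (p : Pt lam) : ptLevel p < row (ptBox p) := by
  rcases p with b | j
  · exact Nat.succ_pos _
  · exact level_lt_row j

/-- The point `t^b_{s-1}` for the variable `t^b_s`. -/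
def pred : Var lam → Pt lam
  | ⟨b, ⟨0, _⟩⟩ => Sum.inl b
  | ⟨b, ⟨s + 1, h⟩⟩ => Sum.inr ⟨b, ⟨s, Nat.lt_of_succ_lt h⟩⟩

@[simp] theorem ptBox_pred (j : Var lam) : ptBox (pred j) = box j := by
  obtain ⟨b, s, hs⟩ := j
  cases s <;> rfl

@[simp] theorem ptLevel_pred (j : Var lam) : ptLevel (pred j) + 1 = level j := by
  obtain ⟨b, s, hs⟩ := j
  cases s <;> rfl

theorem eq_pred_iff {j : Var lam} {q : Pt lam} :
    q = pred j ↔ ptLevel q + 1 = level j ∧ ptBox q = box j := by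
  constructor
  · rintro rfl; simp
  · rintro ⟨h1, h2⟩
    refine pt_ext (by simpa using h2) ?_
    have := ptLevel_pred j
    omega

theorem ptVal_pred (w : Box lam → ℂ) (t : Var lam → ℂ) (j : Var lam) :
    ptVal w t (pred j) = chain w t (box j) j.2 := by
  obtain ⟨b, s, hs⟩ := j
  cases s with
  | zero => rfl
  | succ s => simp [pred, chain, box, Nat.lt_of_succ_lt hs]

theorem chain_succ (w : Box lam → ℂ) (t : Var lam → ℂ) (j : Var lam) :
    chain w t (box j) ((j.2 : ℕ) + 1) = t j := by
  obtain ⟨b, s, hs⟩ := j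
  simp [chain, box, hs]

theorem card_pt (s : ℕ) (b : Box lam) :
    (Finset.univ.filter fun p : Pt lam => ptLevel p = s ∧ ReadBefore (ptBox p) b).card =
      before s b := by
  unfold before
  rw [Fintype.card_subtype]
  refine Finset.card_bij (fun p _ => ptBox p) (fun p hp => ?_) (fun p hp q hq h => ?_)
    fun b' hb' => ?_
  · simp only [Finset.mem_filter, Finset.mem_univ, true_and] at hp ⊢
    exact ⟨hp.2, hp.1 ▸ ptLevel_lt_row p⟩
  · simp only [Finset.mem_filter, Finset.mem_univ, true_and] at hp hq
    exact pt_ext h (hp.1.trans hq.1.symm)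
  · simp only [Finset.mem_filter, Finset.mem_univ, true_and] at hb'
    obtain ⟨p, hp, hl⟩ := exists_pt b' hb'.2
    refine ⟨p, ?_, hp⟩
    simp only [Finset.mem_filter, Finset.mem_univ, true_and]
    exact ⟨hl, hp ▸ hb'.1⟩

/-- The master function in terms of the points; the points `z_{T(b)}` and the variables `t^b_s`
enter it in the same way. -/
def masterPt (w : Box lam → ℂ) (t : Var lam → ℂ) : ℂ :=
  (∏ q : Pt lam, ∏ p : Pt lam with ptLevel p = ptLevel q ∧ ReadBefore (ptBox p) (ptBox q),
    (ptVal w t p - ptVal w t q) ^ 2) *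
  ∏ p : Pt lam, ∏ q : Pt lam with ptLevel q + 1 = ptLevel p, (ptVal w t p - ptVal w t q)⁻¹

theorem masterFunction_eq (z : Fin lam.card → ℂ) (t : Var lam → ℂ) :
    masterFunction lam z t = masterPt (z ∘ rowReading lam) t := by
  have h1 : (∏ p : Fin lam.card × Fin lam.card with p.1 < p.2, (z p.1 - z p.2) ^ 2) =
      ∏ q : Box lam, ∏ p : Box lam, if ReadBefore p q then
        (z (rowReading lam p) - z (rowReading lam q)) ^ 2 else 1 := by
    rw [Finset.prod_filter, Fintype.prod_prod_type_right]
    refine (Fintype.prod_equiv (rowReading lam) _ _ fun q => ?_).symm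
    refine Fintype.prod_equiv (rowReading lam) _ _ fun p => ?_
    simp only [← rowReading_lt_iff, label, add_lt_add_iff_right, Fin.val_fin_lt]
  have h4 : (∏ j : Var lam with level j = 1, ∏ k : Fin lam.card, (t j - z k)⁻¹) =
      ∏ j : Var lam, ∏ b : Box lam, if 1 = level j then (t j - z (rowReading lam b))⁻¹ else 1 := by
    rw [Finset.prod_filter]
    refine Finset.prod_congr rfl fun j _ => ?_
    by_cases hj : level j = 1
    · simp only [hj, if_true]
      exact (Fintype.prod_equiv (rowReading lam) _ _ fun _ => rfl).symm
    · simp [hj, Ne.symm hj]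
  unfold masterFunction masterPt
  rw [h1, h4]
  simp only [Finset.prod_filter, Fintype.prod_sum_type, Fintype.prod_prod_type_right, ptBox_inl,
    ptBox_inr, ptLevel_inl, ptLevel_inr, ptVal_inl, ptVal_inr, level_ne_zero,
    (level_ne_zero _).symm, false_and, true_and, if_false, Finset.prod_const_one, mul_one, one_mul,
    Nat.succ_ne_zero, Function.comp_apply, zero_add, Finset.prod_mul_distrib]
  rw [Finset.prod_comm (f := fun (y x : Var lam) => if level x = level y + 1 then _ else _)]
  simp only [eq_comm (a := level _) (b := level _ + 1)]
  rw [mul_assoc, mul_comm (∏ x, _) (∏ x, ∏ b, if 1 = _ then _ else _)]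
  congr!

theorem phi_eq (T : Numbering lam) (z : Fin lam.card → ℂ) (t : Var lam → ℂ) :
    phi T z t = ∏ j, (t j - ptVal (z ∘ T) t (pred j))⁻¹ := by
  unfold phi
  simp only [Finset.prod_filter, Fintype.prod_prod_type]
  rw [← Finset.prod_mul_distrib]
  refine Finset.prod_congr rfl fun j _ => ?_
  have hcond : ∀ i : Var lam, (level j = level i + 1 ∧ box j = box i) ↔ Sum.inr i = pred j := by
    intro i
    rw [eq_pred_iff]
    simp only [ptLevel_inr, ptBox_inr]
    exact and_congr eq_comm eq_comm
  simp only [hcond]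
  rcases hp : pred j with b | i
  · have h1 := ptLevel_pred j
    have h2 := ptBox_pred j
    rw [hp] at h1 h2
    simp only [ptLevel_inl, zero_add, ptBox_inl] at h1 h2
    simp [← h1, h2]
  · have h1 := ptLevel_pred j
    rw [hp, ptLevel_inr] at h1
    have h2 : level j ≠ 1 := by have := level_ne_zero i; omega
    simp [h2]

/-- The product over ordered pairs, which is visibly invariant under permutations, is up to sign the
product of squares over unordered pairs. -/
theorem prod_sub_of_ne_eq (t : Var lam → ℂ) :
    (∏ p : Var lam × Var lam with level p.1 = level p.2 ∧ p.1 ≠ p.2, (t p.1 - t p.2)) =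
      (-1) ^ (Finset.univ.filter fun p : Var lam × Var lam =>
        level p.1 = level p.2 ∧ ReadBefore (box p.1) (box p.2)).card *
      ∏ p : Var lam × Var lam with level p.1 = level p.2 ∧ ReadBefore (box p.1) (box p.2),
        (t p.1 - t p.2) ^ 2 := by
  set S := Finset.univ.filter fun p : Var lam × Var lam =>
    level p.1 = level p.2 ∧ ReadBefore (box p.1) (box p.2) with hS
  have hunion : (Finset.univ.filter fun p : Var lam × Var lam =>
      level p.1 = level p.2 ∧ p.1 ≠ p.2) = S ∪ S.map (Equiv.prodComm _ _).toEmbedding := by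
    ext ⟨i, j⟩
    simp only [hS, Finset.mem_filter, Finset.mem_univ, true_and, Finset.mem_union,
      Finset.mem_map_equiv, Equiv.prodComm_symm, Equiv.prodComm_apply, Prod.swap_prod_mk]
    constructor
    · rintro ⟨hl, hne⟩
      rcases readBefore_or_of_ne (fun hb => hne (var_ext hb hl)) with h | h
      · exact Or.inl ⟨hl, h⟩
      · exact Or.inr ⟨hl.symm, h⟩
    · rintro (⟨hl, h⟩ | ⟨hl, h⟩)
      · exact ⟨hl, fun hij => h.ne (by rw [hij])⟩
      · exact ⟨hl.symm, fun hij => h.ne (by rw [hij])⟩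
  have hdisj : Disjoint S (S.map (Equiv.prodComm _ _).toEmbedding) := by
    rw [Finset.disjoint_left]
    rintro ⟨i, j⟩ h1 h2
    simp only [hS, Finset.mem_filter, Finset.mem_univ, true_and,
      Finset.mem_map_equiv, Equiv.prodComm_symm, Equiv.prodComm_apply, Prod.swap_prod_mk] at h1 h2
    exact h1.2.asymm h2.2
  rw [hunion, Finset.prod_union hdisj, Finset.prod_map, ← Finset.prod_mul_distrib,
    ← Finset.prod_const, ← Finset.prod_mul_distrib]
  refine Finset.prod_congr rfl fun p _ => ?_
  simp only [Equiv.coe_toEmbedding, Equiv.prodComm_apply, Prod.fst_swap, Prod.snd_swap]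
  ring

theorem masterFunction_comp (z : Fin lam.card → ℂ) (t : Var lam → ℂ) {h : Equiv.Perm (Var lam)}
    (hh : h ∈ levelGroup lam) : masterFunction lam z (t ∘ h) = masterFunction lam z t := by
  have hl : ∀ j, level (h j) = level j := hh
  have h2 : (∏ p : Var lam × Var lam with level p.1 = level p.2 ∧ ReadBefore (box p.1) (box p.2),
        ((t ∘ h) p.1 - (t ∘ h) p.2) ^ 2) =
      ∏ p : Var lam × Var lam with level p.1 = level p.2 ∧ ReadBefore (box p.1) (box p.2),
        (t p.1 - t p.2) ^ 2 := by
    have h3 : (∏ p : Var lam × Var lam with level p.1 = level p.2 ∧ p.1 ≠ p.2,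
          ((t ∘ h) p.1 - (t ∘ h) p.2)) =
        ∏ p : Var lam × Var lam with level p.1 = level p.2 ∧ p.1 ≠ p.2, (t p.1 - t p.2) := by
      simp only [Finset.prod_filter]
      refine Fintype.prod_equiv (h.prodCongr h) _ _ fun p => ?_
      simp [hl]
    rw [prod_sub_of_ne_eq, prod_sub_of_ne_eq] at h3
    exact mul_left_cancel₀ (pow_ne_zero _ (by norm_num)) h3
  unfold masterFunction
  rw [h2]
  congr 1
  · congr 1
    simp only [Finset.prod_filter]
    refine Fintype.prod_equiv (h.prodCongr h) _ _ fun p => ?_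
    simp [hl]
  · simp only [Finset.prod_filter]
    refine Fintype.prod_equiv h _ _ fun p => ?_
    simp [hl]

/-- The differences `t^b_{s+1} - t^{b'}_s` are divided into those with `b = b'`, those where `b'`
is read before `b`, and those where `b` is read before `b'`. -/
theorem prod_adjacent_eq (f : Pt lam → Pt lam → ℂ) :
    (∏ p : Pt lam, ∏ q : Pt lam with ptLevel q + 1 = ptLevel p, f p q) =
      (∏ j : Var lam, f (Sum.inr j) (pred j)) *
      (∏ p : Pt lam, ∏ q : Pt lam with ptLevel q + 1 = ptLevel p ∧ ReadBefore (ptBox q) (ptBox p),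
        f p q) *
      ∏ q : Pt lam, ∏ p : Pt lam with ptLevel p = ptLevel q + 1 ∧ ReadBefore (ptBox p) (ptBox q),
        f p q := by
  have h3 : (∏ q : Pt lam, ∏ p : Pt lam with
      ptLevel p = ptLevel q + 1 ∧ ReadBefore (ptBox p) (ptBox q), f p q) =
      ∏ p : Pt lam, ∏ q : Pt lam with ptLevel q + 1 = ptLevel p ∧ ReadBefore (ptBox p) (ptBox q),
        f p q := by
    simp only [Finset.prod_filter]
    rw [Finset.prod_comm]
    simp only [eq_comm]
  have h1 : (∏ j : Var lam, f (Sum.inr j) (pred j)) =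
      ∏ p : Pt lam, ∏ q : Pt lam with ptLevel q + 1 = ptLevel p ∧ ptBox p = ptBox q, f p q := by
    rw [Fintype.prod_sum_type]
    have : ∀ j : Var lam, (Finset.univ.filter fun q : Pt lam =>
        ptLevel q + 1 = ptLevel (Sum.inr j : Pt lam) ∧ ptBox (Sum.inr j : Pt lam) = ptBox q) =
        {pred j} := by
      intro j
      ext q
      rw [Finset.mem_filter_univ, Finset.mem_singleton, eq_pred_iff]
      exact and_congr_right fun _ => eq_comm
    simp only [this, Finset.prod_singleton]
    simp
  rw [h3, h1, ← Finset.prod_mul_distrib, ← Finset.prod_mul_distrib]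
  refine Finset.prod_congr rfl fun p _ => ?_
  simp only [Finset.prod_filter]
  rw [← Finset.prod_mul_distrib, ← Finset.prod_mul_distrib]
  refine Finset.prod_congr rfl fun q _ => ?_
  by_cases hl : ptLevel q + 1 = ptLevel p
  · by_cases hb : ptBox p = ptBox q
    · have hn : ¬ ReadBefore (ptBox q) (ptBox q) := fun h => h.ne rfl
      simp [hl, hb, hn]
    · rcases readBefore_or_of_ne hb with h | h <;> simp [hl, hb, h, h.asymm]
  · simp [hl]

/-! ### The leading term -/

/-- The leading term of the integrand: every difference of the positions of two points with
different boxes is replaced by the position, up to sign, of the one whose box is read last. -/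
def leadTerm (m : ℕ) (w : Box lam → ℂ) (t : Var lam → ℂ) : ℂ :=
  ((∏ q : Pt lam, ∏ p : Pt lam with ptLevel p = ptLevel q ∧ ReadBefore (ptBox p) (ptBox q),
      (-ptVal w t q) ^ 2) *
    ((∏ j : Var lam, (t j - ptVal w t (pred j))⁻¹) *
    (∏ p : Pt lam, ∏ q : Pt lam with ptLevel q + 1 = ptLevel p ∧ ReadBefore (ptBox q) (ptBox p),
      (ptVal w t p)⁻¹) *
    ∏ q : Pt lam, ∏ p : Pt lam with ptLevel p = ptLevel q + 1 ∧ ReadBefore (ptBox p) (ptBox q),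
      (-ptVal w t q)⁻¹)) ^ m *
  (∏ j : Var lam, (t j - ptVal w t (pred j))⁻¹) * ∏ j : Var lam, (t j - w (box j))

/-- The integrand in terms of the points. -/
def permTerm (m : ℕ) (w : Box lam → ℂ) (h : Equiv.Perm (Var lam)) (t : Var lam → ℂ) : ℂ :=
  masterPt w t ^ m * (∏ j : Var lam, (t (h j) - ptVal w (t ∘ h) (pred j))⁻¹) *
    ∏ j : Var lam, (t j - w (box j))

theorem integrand_eq (m : ℕ) (z : Fin lam.card → ℂ) {h : Equiv.Perm (Var lam)}
    (hh : h ∈ levelGroup lam) (t : Var lam → ℂ) :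
    integrand m (rowReading lam) z h t = permTerm m (z ∘ rowReading lam) h t := by
  unfold integrand
  rw [masterFunction_comp z t hh, masterFunction_eq, phi_eq]
  rfl

/-- The sign with which the leading term enters. -/
def leadSign (lam : YoungDiagram) (m : ℕ) : ℤ :=
  ∏ q : Pt lam, (-1) ^ (m * before (ptLevel q + 1) (ptBox q))

theorem prod_boxFactor_eq (m : ℕ) (w : Box lam → ℂ) (t : Var lam → ℂ) :
    ∏ b, boxFactor m w t b (row b - 1) =
      (∏ q : Pt lam, ptVal w t q ^ expo m (ptBox q) (ptLevel q)) *
      (∏ j : Var lam, (t j - ptVal w t (pred j))⁻¹) ^ (m + 1) *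
      ∏ j : Var lam, (t j - w (box j)) := by
  have h1 : ∀ b, boxFactor m w t b (row b - 1) =
      w b ^ expo m b 0 * ∏ i : Fin (row b - 1), chainFactor m w t b i := by
    intro b
    rw [boxFactor, tailExpo_last, Finset.Ico_self, Finset.prod_empty, one_mul, zpow_zero, mul_one,
      Finset.prod_range]
  simp only [h1]
  have h2 : (∏ j : Var lam, ptVal w t (Sum.inr j) ^
      expo m (ptBox (Sum.inr j : Pt lam)) (ptLevel (Sum.inr j : Pt lam))) *
      ((∏ j : Var lam, ((t j - ptVal w t (pred j))⁻¹) ^ (m + 1)) *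
        ∏ j : Var lam, (t j - w (box j))) =
      ∏ b : Box lam, ∏ i : Fin (row b - 1), chainFactor m w t b i := by
    rw [← Finset.prod_mul_distrib, ← Finset.prod_mul_distrib, Fintype.prod_sigma]
    refine Finset.prod_congr rfl fun b _ => Finset.prod_congr rfl fun i _ => ?_
    have h2 := ptVal_pred w t ⟨b, i⟩
    have h3 := chain_succ w t ⟨b, i⟩
    simp only [box] at h2 h3
    simp only [chainFactor, h2, h3, ptVal_inr, ptBox_inr, ptLevel_inr, level, box]
    ring
  rw [Finset.prod_mul_distrib, Fintype.prod_sum_type, ← Finset.prod_pow, mul_assoc, mul_assoc, h2]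
  rfl


theorem leadTerm_eq (m : ℕ) {w : Box lam → ℂ} {t : Var lam → ℂ} (h0 : ∀ q, ptVal w t q ≠ 0) :
    leadTerm m w t = leadSign lam m * ∏ b, boxFactor m w t b (row b - 1) := by
  rw [prod_boxFactor_eq]
  unfold leadTerm leadSign
  push_cast
  have key : ∀ q : Pt lam,
      ((∏ p : Pt lam with ptLevel p = ptLevel q ∧ ReadBefore (ptBox p) (ptBox q),
        (-ptVal w t q) ^ 2) *
      (∏ p : Pt lam with ptLevel p + 1 = ptLevel q ∧ ReadBefore (ptBox p) (ptBox q),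
        (ptVal w t q)⁻¹) *
      ∏ p : Pt lam with ptLevel p = ptLevel q + 1 ∧ ReadBefore (ptBox p) (ptBox q),
        (-ptVal w t q)⁻¹) ^ m =
      (-1) ^ (m * before (ptLevel q + 1) (ptBox q)) *
        ptVal w t q ^ expo m (ptBox q) (ptLevel q) := by
    intro q
    have hq := h0 q
    rw [Finset.prod_const, Finset.prod_const, Finset.prod_const, card_pt, card_pt]
    generalize ptVal w t q = y at hq
    have hs : ((-y)⁻¹) = (-1) * y⁻¹ := by rw [inv_neg, neg_one_mul]
    rw [hs, neg_sq, mul_pow (-1 : ℂ), pow_mul', ← mul_assoc, mul_right_comm, mul_comm, mul_assoc,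
      mul_pow]
    congr 1
    rcases hl : ptLevel q with _ | s
    · have : (Finset.univ.filter fun p : Pt lam =>
          ptLevel p + 1 = 0 ∧ ReadBefore (ptBox p) (ptBox q)) = ∅ := by
        ext; simp
      rw [this, Finset.card_empty, pow_zero]
      simp only [expo]
      rw [mul_comm (m : ℤ), zpow_mul, zpow_natCast, zpow_sub₀ hq, zpow_mul]
      norm_cast
      rw [div_eq_mul_inv, one_mul, inv_pow]
    · simp only [add_left_inj, card_pt, expo]
      rw [mul_comm (m : ℤ), zpow_mul, zpow_natCast, zpow_sub₀ hq, zpow_sub₀ hq, zpow_mul]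
      norm_cast
      rw [div_eq_mul_inv, div_eq_mul_inv, ← inv_pow, ← inv_pow]
      ring
  have hall := Finset.prod_congr (rfl : (Finset.univ : Finset (Pt lam)) = Finset.univ)
    fun q _ => key q
  rw [Finset.prod_pow, Finset.prod_mul_distrib, Finset.prod_mul_distrib,
    Finset.prod_mul_distrib] at hall
  linear_combination ((∏ j : Var lam, (t j - ptVal w t (pred j))⁻¹) ^ (m + 1) *
    ∏ j : Var lam, (t j - w (box j))) * hall

/-! ### Uniform asymptotics of the integrand -/

/-- The circle of `t^b_s` about `w b` has radius `s` times this number. -/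
def radius (w : Box lam → ℂ) (b : Box lam) : ℝ := ‖w b‖ / (4 * row b)

theorem row_pos (b : Box lam) : (0 : ℝ) < row b := Nat.cast_pos.2 (Nat.succ_pos _)

theorem radius_mul_row (w : Box lam → ℂ) (b : Box lam) : radius w b * row b = ‖w b‖ / 4 := by
  have := row_pos b
  unfold radius
  field_simp

/-- The triples `(δ, w, t)` where the points `w b` grow at least by a factor `1 / δ` in the reading
order and `t` lies on the torus with the radii above. -/
def region (lam : YoungDiagram) : Set (ℝ × (Box lam → ℂ) × (Var lam → ℂ)) :=
  {x | (∀ b, x.2.1 b ≠ 0) ∧ (∀ b b', ReadBefore b b' → ‖x.2.1 b‖ ≤ x.1 * ‖x.2.1 b'‖) ∧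
    ∀ j, ‖x.2.2 j - x.2.1 (box j)‖ = radius x.2.1 (box j) * level j}

/-- The filter `δ → 0` on the triples `(δ, w, t)` of the region. Asymptotic relations along it are
uniform in `w` and `t`. -/
def limitFilter (lam : YoungDiagram) : Filter (ℝ × (Box lam → ℂ) × (Var lam → ℂ)) :=
  comap Prod.fst (𝓝[>] 0) ⊓ 𝓟 (region lam)

theorem eventually_limitFilter {P : ℝ × (Box lam → ℂ) × (Var lam → ℂ) → Prop} :
    (∀ᶠ x in limitFilter lam, P x) ↔
      ∀ᶠ δ in 𝓝[>] (0 : ℝ), ∀ w t, (δ, w, t) ∈ region lam → P (δ, w, t) := by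
  rw [limitFilter, eventually_inf_principal, eventually_comap]
  refine eventually_congr (Eventually.of_forall fun δ => ?_)
  constructor
  · exact fun h w t hx => h _ rfl hx
  · rintro h ⟨δ', w, t⟩ rfl hx
    exact h w t hx

theorem eventually_region : ∀ᶠ x in limitFilter lam, x ∈ region lam :=
  eventually_limitFilter.2 (Eventually.of_forall fun _ _ _ h => h)

theorem norm_ptVal_sub_le {x : ℝ × (Box lam → ℂ) × (Var lam → ℂ)} (hx : x ∈ region lam)
    (p : Pt lam) : ‖ptVal x.2.1 x.2.2 p - x.2.1 (ptBox p)‖ ≤ ‖x.2.1 (ptBox p)‖ / 4 := by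
  rcases p with b | j
  · rw [ptVal_inl, ptBox_inl, sub_self, norm_zero]
    positivity
  · rw [ptVal_inr, ptBox_inr, hx.2.2 j, ← radius_mul_row]
    refine mul_le_mul_of_nonneg_left (Nat.cast_le.2 (level_lt_row j).le) ?_
    unfold radius
    positivity

theorem norm_ptVal_le {x : ℝ × (Box lam → ℂ) × (Var lam → ℂ)} (hx : x ∈ region lam)
    (p : Pt lam) : ‖ptVal x.2.1 x.2.2 p‖ ≤ 2 * ‖x.2.1 (ptBox p)‖ := by
  have h1 := norm_ptVal_sub_le hx p
  have h2 := norm_le_norm_add_norm_sub' (ptVal x.2.1 x.2.2 p) (x.2.1 (ptBox p))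
  have := norm_nonneg (x.2.1 (ptBox p))
  linarith

theorem le_norm_ptVal {x : ℝ × (Box lam → ℂ) × (Var lam → ℂ)} (hx : x ∈ region lam)
    (p : Pt lam) : ‖x.2.1 (ptBox p)‖ ≤ 2 * ‖ptVal x.2.1 x.2.2 p‖ := by
  have h1 := norm_ptVal_sub_le hx p
  have h2 := norm_le_norm_add_norm_sub (ptVal x.2.1 x.2.2 p) (x.2.1 (ptBox p))
  have := norm_nonneg (x.2.1 (ptBox p))
  linarith

theorem ptVal_ne_zero {x : ℝ × (Box lam → ℂ) × (Var lam → ℂ)} (hx : x ∈ region lam)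
    (p : Pt lam) : ptVal x.2.1 x.2.2 p ≠ 0 := by
  intro h
  have h1 := le_norm_ptVal hx p
  rw [h, norm_zero, mul_zero] at h1
  exact hx.1 _ (norm_le_zero_iff.1 h1)

theorem isTheta_ptVal (p : Pt lam) :
    (fun x => ptVal x.2.1 x.2.2 p) =Θ[limitFilter lam] fun x => x.2.1 (ptBox p) := by
  constructor
  · exact IsBigO.of_bound 2 (eventually_region.mono fun x hx => norm_ptVal_le hx p)
  · exact IsBigO.of_bound 2 (eventually_region.mono fun x hx => le_norm_ptVal hx p)

theorem isLittleO_center {b b' : Box lam} (h : ReadBefore b b') :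
    (fun x => x.2.1 b) =o[limitFilter lam] fun x => x.2.1 b' := by
  refine isLittleO_iff.2 fun c hc => eventually_limitFilter.2 ?_
  have : ∀ᶠ δ in 𝓝[>] (0 : ℝ), δ ≤ c :=
    eventually_nhdsWithin_of_eventually_nhds (eventually_le_nhds hc)
  filter_upwards [this] with δ hδ w t hx
  exact (hx.2.1 b b' h).trans (mul_le_mul_of_nonneg_right hδ (norm_nonneg _))

theorem isLittleO_ptVal {p q : Pt lam} (h : ReadBefore (ptBox p) (ptBox q)) :
    (fun x => ptVal x.2.1 x.2.2 p) =o[limitFilter lam] fun x => ptVal x.2.1 x.2.2 q :=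
  (isTheta_ptVal p).trans_isLittleO ((isLittleO_center h).trans_isTheta (isTheta_ptVal q).symm)

/-- The position of the point whose box is read last dominates. -/
theorem isEquivalent_sub {p q : Pt lam} (h : ReadBefore (ptBox q) (ptBox p)) :
    (fun x => ptVal x.2.1 x.2.2 p - ptVal x.2.1 x.2.2 q) ~[limitFilter lam]
      fun x => ptVal x.2.1 x.2.2 p :=
  IsEquivalent.refl.sub_isLittleO (isLittleO_ptVal h)

theorem isEquivalent_sub' {p q : Pt lam} (h : ReadBefore (ptBox p) (ptBox q)) :
    (fun x => ptVal x.2.1 x.2.2 p - ptVal x.2.1 x.2.2 q) ~[limitFilter lam]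
      fun x => -ptVal x.2.1 x.2.2 q := by
  have := (isEquivalent_sub h).neg
  simpa only [neg_sub] using this

theorem isTheta_sub_center (j : Var lam) :
    (fun x => x.2.2 j - x.2.1 (box j)) =Θ[limitFilter lam] fun x => x.2.1 (box j) := by
  have hpos : (0 : ℝ) < level j / (4 * row (box j)) :=
    div_pos (Nat.cast_pos.2 (level_pos j)) (mul_pos four_pos (row_pos _))
  have key : ∀ᶠ x in limitFilter lam, ‖x.2.2 j - x.2.1 (box j)‖ =
      level j / (4 * row (box j)) * ‖x.2.1 (box j)‖ :=
    eventually_region.mono fun x hx => by rw [hx.2.2 j, radius]; ring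
  constructor
  · exact IsBigO.of_bound _ (key.mono fun x hx => hx.le)
  · refine IsBigO.of_bound (level j / (4 * row (box j)) : ℝ)⁻¹ (key.mono fun x hx => ?_)
    rw [hx, inv_mul_cancel_left₀ hpos.ne']

/-- Consecutive variables of a box lie on circles whose radii differ by a fixed multiple
of `|w b|`. -/
theorem isTheta_sub_pred (j : Var lam) :
    (fun x => x.2.2 j - ptVal x.2.1 x.2.2 (pred j)) =Θ[limitFilter lam]
      fun x => x.2.1 (box j) := by
  constructor
  · have h := (isTheta_ptVal (pred j)).1
    rw [ptBox_pred] at h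
    exact (isTheta_ptVal (Sum.inr j)).1.sub h
  · refine IsBigO.of_bound (4 * row (box j)) (eventually_region.mono fun x hx => ?_)
    have h1 : ‖ptVal x.2.1 x.2.2 (pred j) - x.2.1 (box j)‖ =
        radius x.2.1 (box j) * (level j - 1) := by
      have hb := ptBox_pred j
      have hl := ptLevel_pred j
      rcases hp : pred j with b | i
      · rw [hp] at hb hl
        simp only [ptBox_inl, ptLevel_inl, ptVal_inl] at hb hl ⊢
        rw [hb, ← hl, sub_self, norm_zero]
        simp
      · rw [hp] at hb hl
        simp only [ptBox_inr, ptLevel_inr, ptVal_inr] at hb hl ⊢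
        rw [← hb, hx.2.2 i, ← hl]
        push_cast
        ring
    have h2 := hx.2.2 j
    have h3 : radius x.2.1 (box j) ≤ ‖x.2.2 j - ptVal x.2.1 x.2.2 (pred j)‖ := by
      have h4 := norm_sub_norm_le (x.2.2 j - x.2.1 (box j))
        (ptVal x.2.1 x.2.2 (pred j) - x.2.1 (box j))
      rw [sub_sub_sub_cancel_right, h1, h2] at h4
      linarith
    have h5 : ‖x.2.1 (box j)‖ = 4 * row (box j) * radius x.2.1 (box j) := by
      have := row_pos (box j)
      unfold radius
      field_simp
    rw [h5]
    exact mul_le_mul_of_nonneg_left h3 (by positivity)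

theorem eventually_center_ne_zero (b : Box lam) : ∀ᶠ x in limitFilter lam, x.2.1 b ≠ 0 :=
  eventually_region.mono fun _ hx => hx.1 b

/-- The integrand for the identity permutation is asymptotic to its leading term. -/
theorem permTerm_one_isEquivalent (m : ℕ) :
    (fun x => permTerm m x.2.1 1 x.2.2) ~[limitFilter lam] fun x => leadTerm m x.2.1 x.2.2 := by
  unfold permTerm leadTerm masterPt
  simp only [prod_adjacent_eq, Equiv.Perm.coe_one, Function.comp_id, id_eq, ptVal_inr]
  refine ((((IsEquivalent.finsetProd fun q _ => IsEquivalent.finsetProd fun p hp => ?_).mul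
    ((IsEquivalent.refl.mul (IsEquivalent.finsetProd fun p _ => IsEquivalent.finsetProd
      fun q hq => ?_)).mul (IsEquivalent.finsetProd fun q _ => IsEquivalent.finsetProd
        fun p hp => ?_))).pow m).mul IsEquivalent.refl).mul IsEquivalent.refl
  · exact (isEquivalent_sub' (Finset.mem_filter.1 hp).2.2).pow 2
  · exact (isEquivalent_sub (Finset.mem_filter.1 hq).2.2).inv
  · exact (isEquivalent_sub' (Finset.mem_filter.1 hp).2.2).inv

theorem isTheta_chain (b : Box lam) {s : ℕ} (hs : s < row b) :
    (fun x => chain x.2.1 x.2.2 b s) =Θ[limitFilter lam] fun x => x.2.1 b := by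
  cases s with
  | zero => exact isTheta_ptVal (Sum.inl b)
  | succ s =>
    have hs' : s < row b - 1 := by omega
    simp only [chain, dif_pos hs']
    exact isTheta_ptVal (Sum.inr ⟨b, ⟨s, hs'⟩⟩)

theorem isTheta_chainFactor (m : ℕ) (b : Box lam) {s : ℕ} (hs : s < row b - 1) :
    (fun x => chainFactor m x.2.1 x.2.2 b s) =Θ[limitFilter lam]
      fun x => x.2.1 b ^ (tailExpo m b s - tailExpo m b (s + 1)) := by
  have h1 := isTheta_sub_pred (⟨b, ⟨s, hs⟩⟩ : Var lam)
  have h2 := isTheta_sub_center (⟨b, ⟨s, hs⟩⟩ : Var lam)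
  simp only [ptVal_pred] at h1
  have h3 := ((isTheta_chain b (by omega : s + 1 < row b)).zpow (expo m b (s + 1))).mul
    (h1.inv.pow (m + 1)) |>.mul h2
  have h4 : (fun x : ℝ × (Box lam → ℂ) × (Var lam → ℂ) =>
      x.2.1 b ^ expo m b (s + 1) * (x.2.1 b)⁻¹ ^ (m + 1) * x.2.1 b) =ᶠ[limitFilter lam]
      fun x => x.2.1 b ^ (tailExpo m b s - tailExpo m b (s + 1)) := by
    filter_upwards [eventually_center_ne_zero b] with x hx
    have he : tailExpo m b s - tailExpo m b (s + 1) = expo m b (s + 1) + -((m : ℤ) + 1) + 1 := by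
      have := expo_add_tailExpo_succ m b s
      linarith
    rw [he, zpow_add₀ hx, zpow_add₀ hx, zpow_one, zpow_neg, inv_pow]
    norm_cast
  refine IsTheta.trans ?_ (h3.trans h4.isTheta)
  refine EventuallyEq.isTheta (Eventually.of_forall fun x => ?_)
  have hc : chain x.2.1 x.2.2 b (s + 1) = x.2.2 ⟨b, ⟨s, hs⟩⟩ := dif_pos hs
  simp only [chainFactor, hc, box]

theorem isTheta_prod_chainFactor (m : ℕ) (b : Box lam) {h : ℕ} (hh : h < row b) :
    (fun x => ∏ s ∈ Finset.range h, chainFactor m x.2.1 x.2.2 b s) =Θ[limitFilter lam]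
      fun x => x.2.1 b ^ (tailExpo m b 0 - tailExpo m b h) := by
  induction h with
  | zero => simpa using isTheta_refl _ _
  | succ h ih =>
    simp only [Finset.prod_range_succ]
    refine ((ih (by omega)).mul (isTheta_chainFactor m b (s := h) (by omega))).trans ?_
    refine EventuallyEq.isTheta ?_
    filter_upwards [eventually_center_ne_zero b] with x hx
    rw [← zpow_add₀ hx]
    congr 1
    ring

/-- The leading monomial, with the exponents in the form in which the iterated residue produces
them. -/
def boxMonomial (m : ℕ) (w : Box lam → ℂ) : ℂ :=
  ∏ b, w b ^ (expo m b 0 + tailExpo m b 0)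

theorem isTheta_prod_boxFactor (m : ℕ) :
    (fun x => ∏ b, boxFactor m x.2.1 x.2.2 b (row b - 1)) =Θ[limitFilter lam]
      fun x => boxMonomial m x.2.1 := by
  unfold boxMonomial
  refine IsTheta.finsetProd fun b _ => ?_
  simp only [boxFactor, tailExpo_last, Finset.Ico_self, Finset.prod_empty, one_mul, zpow_zero,
    mul_one]
  have hr : row b - 1 < row b := Nat.sub_lt (Nat.succ_pos _) one_pos
  refine ((isTheta_refl _ _).mul (isTheta_prod_chainFactor m b hr)).trans ?_
  refine EventuallyEq.isTheta ?_
  filter_upwards [eventually_center_ne_zero b] with x hx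
  rw [tailExpo_last, sub_zero, zpow_add₀ hx]

theorem isBigO_leadTerm (m : ℕ) :
    (fun x => leadTerm m x.2.1 x.2.2) =O[limitFilter lam] fun x => boxMonomial m x.2.1 := by
  have h : (fun x => leadTerm m x.2.1 x.2.2) =ᶠ[limitFilter lam]
      fun x => (leadSign lam m : ℂ) * ∏ b, boxFactor m x.2.1 x.2.2 b (row b - 1) :=
    eventually_region.mono fun x hx => leadTerm_eq m (ptVal_ne_zero hx)
  exact h.trans_isBigO ((isTheta_prod_boxFactor m).1.const_mul_left _)

/-- The action of a permutation of the variables on the points. -/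
def ptPerm (h : Equiv.Perm (Var lam)) : Pt lam → Pt lam := Sum.map id h

theorem ptVal_comp (w : Box lam → ℂ) (t : Var lam → ℂ) (h : Equiv.Perm (Var lam)) (p : Pt lam) :
    ptVal w (t ∘ h) p = ptVal w t (ptPerm h p) := by
  rcases p with b | j <;> rfl

theorem ptLevel_ptPerm {h : Equiv.Perm (Var lam)} (hh : h ∈ levelGroup lam) (p : Pt lam) :
    ptLevel (ptPerm h p) = ptLevel p := by
  rcases p with b | j
  · rfl
  · exact hh j

/-- The difference of two points of adjacent levels is at least of the order of the outer one. -/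
theorem isBigO_center_sub {p q : Pt lam} (hl : ptLevel q + 1 = ptLevel p) :
    (fun x => x.2.1 (ptBox p)) =O[limitFilter lam]
      fun x => ptVal x.2.1 x.2.2 p - ptVal x.2.1 x.2.2 q := by
  by_cases hb : ptBox p = ptBox q
  · rcases p with b | j
    · exact absurd hl (Nat.succ_ne_zero _)
    · have hq : q = pred j := eq_pred_iff.2 ⟨hl, hb.symm⟩
      subst hq
      exact (isTheta_sub_pred j).2
  · rcases readBefore_or_of_ne hb with h | h
    · refine (isLittleO_center h).isBigO.trans ?_
      refine (isTheta_ptVal q).2.trans ?_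
      have := (isEquivalent_sub' h).isBigO_symm
      simpa using this
    · exact (isTheta_ptVal p).2.trans (isEquivalent_sub h).isBigO_symm

theorem isLittleO_center_sub {p q : Pt lam} (h : ReadBefore (ptBox p) (ptBox q)) :
    (fun x => x.2.1 (ptBox p)) =o[limitFilter lam]
      fun x => ptVal x.2.1 x.2.2 p - ptVal x.2.1 x.2.2 q := by
  refine (isLittleO_center h).trans_isBigO ((isTheta_ptVal q).2.trans ?_)
  have := (isEquivalent_sub' h).isBigO_symm
  simpa using this

/-- Among the variables of minimal level moved by `h`, the one whose box is read last is moved to a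
box read earlier, while its predecessor, of lower level, is fixed. -/
theorem exists_readBefore {h : Equiv.Perm (Var lam)} (hh : h ∈ levelGroup lam) (h1 : h ≠ 1) :
    ∃ j, ReadBefore (box (h j)) (ptBox (ptPerm h (pred j))) := by
  have hl : ∀ j, level (h j) = level j := hh
  obtain ⟨j0, hj0⟩ : ∃ j, h j ≠ j := by
    by_contra! hc
    exact h1 (Equiv.ext hc)
  obtain ⟨i, hi, himin⟩ := Finset.exists_min_image (Finset.univ.filter fun j => h j ≠ j) level
    ⟨j0, by simpa using hj0⟩
  simp only [Finset.mem_filter, Finset.mem_univ, true_and] at hi himin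
  obtain ⟨j, hj, hjmax⟩ := Finset.exists_max_image
    (Finset.univ.filter fun j => h j ≠ j ∧ level j = level i)
    (fun j => label (rowReading lam) (box j)) ⟨i, by simpa using hi⟩
  simp only [Finset.mem_filter, Finset.mem_univ, true_and] at hj hjmax
  have hpred : ptPerm h (pred j) = pred j := by
    have hlp := ptLevel_pred j
    rcases hp : pred j with b | k
    · rfl
    · rw [hp, ptLevel_inr] at hlp
      refine congrArg Sum.inr ?_
      by_contra hk
      have := himin k hk
      omega
  refine ⟨j, ?_⟩
  rw [hpred, ptBox_pred]
  have hne : box (h j) ≠ box j := fun hb => hj.1 (var_ext hb (hl j))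
  rcases readBefore_or_of_ne hne with hr | hr
  · exact hr
  · have h2 := hjmax (h j) ⟨fun h3 => hj.1 (h.injective h3), (hl j).trans hj.2⟩
    have h3 := (rowReading_lt_iff _ _).2 hr
    omega

theorem isLittleO_prod_inv {h : Equiv.Perm (Var lam)} (hh : h ∈ levelGroup lam) (h1 : h ≠ 1) :
    (fun x => ∏ j : Var lam, (x.2.2 (h j) - ptVal x.2.1 (x.2.2 ∘ h) (pred j))⁻¹)
      =o[limitFilter lam] fun x => ∏ j : Var lam, (x.2.2 j - ptVal x.2.1 x.2.2 (pred j))⁻¹ := by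
  have hlev : ∀ j, ptLevel (ptPerm h (pred j)) + 1 = ptLevel (Sum.inr (h j) : Pt lam) := by
    intro j
    rw [ptLevel_ptPerm hh, ptLevel_pred, ptLevel_inr]
    exact (hh j).symm
  have hz : ∀ (b : Box lam) (f : ℝ × (Box lam → ℂ) × (Var lam → ℂ) → ℂ),
      ∀ᶠ x in limitFilter lam, x.2.1 b = 0 → f x = 0 :=
    fun b f => (eventually_center_ne_zero b).mono fun x hx h0 => absurd h0 hx
  simp only [ptVal_comp]
  have ho : (fun x => ∏ j : Var lam, (x.2.2 (h j) - ptVal x.2.1 x.2.2 (ptPerm h (pred j)))⁻¹)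
      =o[limitFilter lam] fun x => ∏ j : Var lam, (x.2.1 (box (h j)))⁻¹ := by
    refine IsLittleO.finsetProd (fun j _ => ?_) ?_
    · exact (isBigO_center_sub (hlev j)).inv_rev (hz _ _)
    · obtain ⟨j, hj⟩ := exists_readBefore hh h1
      exact ⟨j, Finset.mem_univ _,
        (isLittleO_center_sub (p := Sum.inr (h j)) hj).inv_rev (hz _ _)⟩
  -- the lower bounds by the outer points do not depend on `h`, as `h` only permutes these points
  have he : ∀ x : ℝ × (Box lam → ℂ) × (Var lam → ℂ),
      ∏ j : Var lam, (x.2.1 (box (h j)))⁻¹ = ∏ j : Var lam, (x.2.1 (box j))⁻¹ :=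
    fun x => Equiv.prod_comp h fun j => (x.2.1 (box j))⁻¹
  simp only [he] at ho
  exact ho.trans_isTheta (IsTheta.finsetProd fun j _ => (isTheta_sub_pred j).inv).symm

/-- Permutations other than the identity contribute terms of lower order. -/
theorem permTerm_isLittleO (m : ℕ) {h : Equiv.Perm (Var lam)} (hh : h ∈ levelGroup lam)
    (h1 : h ≠ 1) :
    (fun x => permTerm m x.2.1 h x.2.2) =o[limitFilter lam] fun x => permTerm m x.2.1 1 x.2.2 := by
  unfold permTerm
  refine ((isBigO_refl _ _).mul_isLittleO ?_).mul_isBigO (isBigO_refl _ _)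
  simpa using isLittleO_prod_inv hh h1

theorem permTerm_sub_isLittleO (m : ℕ) {h : Equiv.Perm (Var lam)} (hh : h ∈ levelGroup lam) :
    (fun x => permTerm m x.2.1 h x.2.2 - if h = 1 then leadTerm m x.2.1 x.2.2 else 0)
      =o[limitFilter lam] fun x => boxMonomial m x.2.1 := by
  by_cases h1 : h = 1
  · subst h1
    simp only [if_true]
    exact (permTerm_one_isEquivalent m).isLittleO.trans_isBigO (isBigO_leadTerm m)
  · simp only [if_neg h1, sub_zero]
    exact (permTerm_isLittleO m hh h1).trans_isBigO
      ((permTerm_one_isEquivalent m).isBigO.trans (isBigO_leadTerm m))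

/-! ### Asymptotics of `ψ_{T,T}` -/

/-- The constant in front of the leading monomial. -/
def leadConst (lam : YoungDiagram) (m : ℕ) : ℤ :=
  leadSign lam m * ∏ b : Box lam, ∏ s ∈ Finset.range (row b - 1), residueFactor m b (s + 1)

theorem leadConst_ne_zero (lam : YoungDiagram) (m : ℕ) : leadConst lam m ≠ 0 := by
  unfold leadConst leadSign
  refine mul_ne_zero (Finset.prod_ne_zero_iff.2 fun q _ => pow_ne_zero _ (by norm_num)) ?_
  exact Finset.prod_ne_zero_iff.2 fun b _ => Finset.prod_ne_zero_iff.2 fun s _ =>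
    residueFactor_ne_zero m b (s + 1)

theorem leadingMonomial_eq (m : ℕ) (z : Fin lam.card → ℂ) :
    leadingMonomial m (rowReading lam) z = boxMonomial m (z ∘ rowReading lam) := by
  unfold leadingMonomial boxMonomial
  simp only [expo_add_tailExpo_zero, Function.comp_apply]

theorem radius_pos {w : Box lam → ℂ} (hw : ∀ b, w b ≠ 0) (b : Box lam) : 0 < radius w b :=
  div_pos (norm_pos_iff.2 (hw b)) (mul_pos four_pos (row_pos b))

theorem polyCircleMap_mem_region {δ : ℝ} {w : Box lam → ℂ} (hw : ∀ b, w b ≠ 0)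
    (hδ : ∀ b b', ReadBefore b b' → ‖w b‖ ≤ δ * ‖w b'‖) (θ : Var lam → ℝ) :
    (δ, w, polyCircleMap (fun j => w (box j)) (fun j => radius w (box j) * level j) θ) ∈
      region lam := by
  refine ⟨hw, hδ, fun j => ?_⟩
  have := radius_pos hw (box j)
  simp only [polyCircleMap, circleMap_sub_center, norm_circleMap_zero]
  exact abs_of_nonneg (by positivity)

/-- The growth condition makes the discs of radii `|w b| / 4` disjoint. -/
theorem isSeparated_of_growth {δ : ℝ} (hδ : δ ≤ 1 / 2) {z : Fin lam.card → ℂ}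
    (hz : ∀ k, z k ≠ 0) (h : ∀ b b', ReadBefore b b' →
      ‖z (rowReading lam b)‖ ≤ δ * ‖z (rowReading lam b')‖) :
    IsSeparated (rowReading lam) z fun b => ‖z (rowReading lam b)‖ / 4 := by
  have key : ∀ b b', ReadBefore b b' →
      ‖z (rowReading lam b)‖ / 4 + ‖z (rowReading lam b')‖ / 4 <
        ‖z (rowReading lam b') - z (rowReading lam b)‖ := by
    intro b b' hb
    have h1 := h b b' hb
    have h2 : 0 < ‖z (rowReading lam b')‖ := norm_pos_iff.2 (hz _)
    have h3 := mul_le_mul_of_nonneg_right hδ h2.le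
    have h4 := norm_sub_norm_le (z (rowReading lam b')) (z (rowReading lam b))
    linarith
  refine ⟨fun b => div_pos (norm_pos_iff.2 (hz _)) four_pos, fun b b' hb => ?_⟩
  rcases readBefore_or_of_ne hb with hr | hr
  · rw [norm_sub_rev]
    exact key b b' hr
  · rw [add_comm]
    exact key b' b hr

/-- The growth condition on consecutive points implies the one on all pairs. -/
theorem growth_of_consecutive {δ : ℝ} (hδ0 : 0 < δ) (hδ : δ ≤ 1) {N : ℕ} {z : Fin N → ℂ}
    (h : ∀ i j : Fin N, (i : ℕ) + 1 = (j : ℕ) → ‖z i‖ ≤ δ * ‖z j‖) (i j : Fin N) (hij : i < j) :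
    ‖z i‖ ≤ δ * ‖z j‖ := by
  obtain ⟨j, hj⟩ := j
  have hij' : (i : ℕ) + 1 ≤ j := hij
  induction j, hij' using Nat.le_induction with
  | base => exact h _ _ rfl
  | succ n hn ih =>
    have h1 := ih (by omega) (Fin.lt_def.2 hn)
    have h2 := h ⟨n, by omega⟩ ⟨n + 1, hj⟩ rfl
    refine h1.trans (mul_le_mul_of_nonneg_left (h2.trans ?_) hδ0.le)
    exact mul_le_of_le_one_left (norm_nonneg _) hδ

theorem continuous_integrand_polyCircleMap (m : ℕ) {z : Fin lam.card → ℂ}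
    {T : Numbering lam} {U : Box lam → ℝ} (hU : IsSeparated T z U)
    {u : Box lam → ℝ} (hu : ∀ b, 0 < u b) (huU : ∀ b, u b * row b ≤ U b)
    {h : Equiv.Perm (Var lam)} (hh : h ∈ levelGroup lam) :
    Continuous fun θ =>
      integrand m T z h (polyCircleMap (center T z) (fun j => u (box j) * level j) θ) := by
  have hlev : ∀ j : Var lam, (0 : ℝ) < level j := fun j => by exact_mod_cast level_pos j
  have hpos : ∀ j : Var lam, 0 < u (box j) * level j := fun j => mul_pos (hu _) (hlev j)
  refine continuous_comp_polyCircleMap fun t ht =>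
    (differentiableAt_integrand m T (nonSingular_of_isSeparated hU ?_ ?_ ?_) hh).continuousAt
  · intro j
    rw [ht j, abs_of_pos (hpos j)]
    exact hpos j
  · intro j
    rw [ht j, abs_of_pos (hpos j)]
    refine le_trans ?_ (huU _)
    exact mul_le_mul_of_nonneg_left (Nat.cast_le.2 (level_lt_row j).le) (hu _).le
  · intro i j hb hl
    rw [ht j, ht i, abs_of_pos (hpos j), abs_of_pos (hpos i), hb, hl]
    refine mul_lt_mul_of_pos_left ?_ (hu _)
    exact Nat.cast_lt.2 (Nat.lt_succ_self _)

theorem radius_mul_row_lt {w : Box lam → ℂ} (hw : ∀ b, w b ≠ 0) (b : Box lam) :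
    radius w b * row b < ‖w b‖ := by
  rw [radius_mul_row]
  have := norm_pos_iff.2 (hw b)
  linarith

theorem leadTerm_polyCircleMap (m : ℕ) {w : Box lam → ℂ} (hw : ∀ b, w b ≠ 0)
    {δ : ℝ} (hδ : ∀ b b', ReadBefore b b' → ‖w b‖ ≤ δ * ‖w b'‖) (θ : Var lam → ℝ) :
    leadTerm m w (polyCircleMap (fun j => w (box j)) (fun j => radius w (box j) * level j) θ) =
      leadSign lam m * ∏ b, boxFactor m w
        (polyCircleMap (fun j => w (box j)) (fun j => radius w (box j) * level j) θ) b
        (row b - 1) :=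
  leadTerm_eq m fun q => ptVal_ne_zero (polyCircleMap_mem_region hw hδ θ) q

theorem row_sub_one_lt (b : Box lam) : row b - 1 < row b := Nat.sub_lt (Nat.succ_pos _) one_pos

theorem torusMean_leadTerm {m : ℕ} (hm : 0 < m) {w : Box lam → ℂ} (hw : ∀ b, w b ≠ 0)
    {δ : ℝ} (hδ : ∀ b b', ReadBefore b b' → ‖w b‖ ≤ δ * ‖w b'‖) :
    torusMean (fun j => w (box j)) (fun j => radius w (box j) * level j) (leadTerm m w) =
      leadConst lam m * boxMonomial m w := by
  rw [torusMean_congr (g := fun t => (leadSign lam m : ℂ) * ∏ b, boxFactor m w t b (row b - 1))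
      (leadTerm_polyCircleMap m hw hδ),
    torusMean_const_mul, torusMean_prod_boxFactor hm (radius_pos hw) (radius_mul_row_lt hw)
      (fun b => row b - 1) row_sub_one_lt, Finset.prod_mul_distrib]
  unfold leadConst boxMonomial
  push_cast
  ring

theorem continuous_leadTerm_polyCircleMap (m : ℕ) {w : Box lam → ℂ} (hw : ∀ b, w b ≠ 0)
    {δ : ℝ} (hδ : ∀ b b', ReadBefore b b' → ‖w b‖ ≤ δ * ‖w b'‖) :
    Continuous fun θ => leadTerm m w
      (polyCircleMap (fun j => w (box j)) (fun j => radius w (box j) * level j) θ) := by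
  simp only [leadTerm_polyCircleMap m hw hδ]
  exact continuous_const.mul (continuous_finsetProd _ fun b _ =>
    continuous_boxFactor m (radius_pos hw) (radius_mul_row_lt hw) b (row_sub_one_lt b))

theorem exists_norm_psi_sub_le {m : ℕ} (hm : 0 < m) {η : ℝ} (hη : 0 < η) :
    ∃ δ : ℝ, 0 < δ ∧ ∀ z : Fin lam.card → ℂ, (∀ k, z k ≠ 0) →
      (∀ i j : Fin lam.card, (i : ℕ) + 1 = (j : ℕ) → ‖z i‖ ≤ δ * ‖z j‖) →
      ‖psi m (rowReading lam) (rowReading lam) z -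
          (leadConst lam m : ℂ) * leadingMonomial m (rowReading lam) z‖ ≤
        η * ‖leadingMonomial m (rowReading lam) z‖ := by
  set n : ℝ := ((Fintype.card (levelGroup lam) : ℕ) : ℝ) with hn
  have hn0 : 0 < n := by
    rw [hn]
    exact Nat.cast_pos.2 Fintype.card_pos
  have hev : ∀ᶠ δ in 𝓝[>] (0 : ℝ), ∀ g : levelGroup lam, ∀ w t, (δ, w, t) ∈ region lam →
      ‖permTerm m w (g : Equiv.Perm (Var lam))⁻¹ t -
        if (g : Equiv.Perm (Var lam))⁻¹ = 1 then leadTerm m w t else 0‖ ≤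
        η / n * ‖boxMonomial m w‖ :=
    eventually_all.2 fun g => eventually_limitFilter.1
      (isLittleO_iff.1 (permTerm_sub_isLittleO m ((levelGroup lam).inv_mem g.2)) (div_pos hη hn0))
  have hhalf : ∀ᶠ δ in 𝓝[>] (0 : ℝ), δ ≤ 1 / 2 :=
    eventually_nhdsWithin_of_eventually_nhds (eventually_le_nhds (by norm_num))
  obtain ⟨δ, ⟨hδ, hδ2⟩, hδ0⟩ := ((hev.and hhalf).and self_mem_nhdsWithin).exists
  have hδ0 : 0 < δ := hδ0
  refine ⟨δ, hδ0, fun z hz hcons => ?_⟩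
  set w : Box lam → ℂ := z ∘ rowReading lam with hw
  have hw0 : ∀ b, w b ≠ 0 := fun b => hz _
  have hgrow : ∀ b b', ReadBefore b b' → ‖w b‖ ≤ δ * ‖w b'‖ := by
    intro b b' hb
    refine growth_of_consecutive hδ0 (hδ2.trans (by norm_num)) hcons _ _ ?_
    have := (rowReading_lt_iff b b').2 hb
    simpa [label] using this
  have hU := isSeparated_of_growth hδ2 hz hgrow
  have huU : ∀ b, radius w b * row b ≤ ‖z (rowReading lam b)‖ / 4 :=
    fun b => (radius_mul_row w b).le
  have hcen : center (rowReading lam) z = fun j => w (box j) := rfl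
  rw [leadingMonomial_eq, ← hw, psi_eq_sum m hU (radius_pos hw0) huU,
    ← torusMean_leadTerm hm hw0 hgrow, hcen]
  have hsum : ∑ g : levelGroup lam, torusMean (fun j => w (box j))
      (fun j => radius w (box j) * level j) (fun t =>
        if (g : Equiv.Perm (Var lam))⁻¹ = 1 then leadTerm m w t else 0) =
      torusMean (fun j => w (box j)) (fun j => radius w (box j) * level j) (leadTerm m w) := by
    rw [Finset.sum_eq_single 1]
    · simp
    · intro g _ hg
      have : ¬ (g : Equiv.Perm (Var lam))⁻¹ = 1 := by simpa using hg
      simp only [if_neg this, torusMean_const]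
    · simp
  rw [← hsum, ← Finset.sum_sub_distrib]
  refine (norm_sum_le_of_le _ fun g _ => ?_).trans (b := ∑ _g : levelGroup lam,
    η / n * ‖boxMonomial m w‖) ?_
  · rw [← torusMean_sub]
    · refine norm_torusMean_le _ _ fun θ => ?_
      have := hδ g w _ (polyCircleMap_mem_region hw0 hgrow θ)
      rwa [integrand_eq m z ((levelGroup lam).inv_mem g.2)]
    · exact continuous_integrand_polyCircleMap m hU (radius_pos hw0) huU
        ((levelGroup lam).inv_mem g.2)
    · split_ifs
      · exact continuous_leadTerm_polyCircleMap m hw0 hgrow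
      · exact continuous_const
  · rw [Finset.sum_const, Finset.card_univ, nsmul_eq_mul, ← hn, ← mul_assoc,
      mul_div_cancel₀ _ hn0.ne']

end KZ

end

theorem mainTheorem2 (lam : YoungDiagram) (m : ℕ) (hm : 0 < m) :
    -- the integral defining `ψ_{T,T}` does not depend on the small parameter `ε`
    (∀ z : Fin lam.card → ℂ, Function.Injective z →
      ∀ᶠ ε in 𝓝[>] (0 : ℝ),
        KZ.cycleIntegral m (KZ.rowReading lam) (KZ.rowReading lam) z ε =
          KZ.psi m (KZ.rowReading lam) (KZ.rowReading lam) z) ∧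
    -- `ψ_{T,T}` is not identically zero on the configuration space
    (∃ z : Fin lam.card → ℂ, Function.Injective z ∧
      KZ.psi m (KZ.rowReading lam) (KZ.rowReading lam) z ≠ 0) ∧
    -- the leading term for `0 ≪ |z_1| ≪ ⋯ ≪ |z_N|`
    (∃ C : ℤ, C ≠ 0 ∧ ∀ η : ℝ, 0 < η → ∃ δ : ℝ, 0 < δ ∧
      ∀ z : Fin lam.card → ℂ, (∀ k, z k ≠ 0) →
        (∀ i j : Fin lam.card, (i : ℕ) + 1 = (j : ℕ) → ‖z i‖ ≤ δ * ‖z j‖) →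
        ‖KZ.psi m (KZ.rowReading lam) (KZ.rowReading lam) z -
            (C : ℂ) * KZ.leadingMonomial m (KZ.rowReading lam) z‖ ≤
          η * ‖KZ.leadingMonomial m (KZ.rowReading lam) z‖) := by
  refine ⟨fun z hz => KZ.eventually_cycleIntegral_eq_psi m _ hz, ?_,
    KZ.leadConst lam m, KZ.leadConst_ne_zero lam m, fun η hη => KZ.exists_norm_psi_sub_le hm hη⟩
  obtain ⟨δ, hδ0, hδ⟩ := KZ.exists_norm_psi_sub_le (lam := lam) hm (η := 1 / 2) (by norm_num)
  set r : ℝ := min δ (1 / 2) with hr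
  have hr0 : 0 < r := lt_min hδ0 (by norm_num)
  have hr1 : r < 1 := (min_le_right _ _).trans_lt (by norm_num)
  -- a geometric progression of ratio `1 / r` satisfies the growth condition
  refine ⟨fun k => ((r⁻¹ ^ (k : ℕ) : ℝ) : ℂ), fun i j hij => ?_, fun h0 => ?_⟩
  · have h1 : r⁻¹ ^ (i : ℕ) = r⁻¹ ^ (j : ℕ) := Complex.ofReal_injective hij
    exact Fin.ext (pow_right_injective₀ (inv_pos.2 hr0) (by simpa using hr1.ne) h1)
  · have hz : ∀ k : Fin lam.card, ((r⁻¹ ^ (k : ℕ) : ℝ) : ℂ) ≠ 0 := fun k =>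
      Complex.ofReal_ne_zero.2 (pow_pos (inv_pos.2 hr0) _).ne'
    have h1 := hδ _ hz fun i j hij => by
      rw [← hij, Complex.norm_real, Complex.norm_real,
        Real.norm_of_nonneg (pow_pos (inv_pos.2 hr0) _).le,
        Real.norm_of_nonneg (pow_pos (inv_pos.2 hr0) _).le, pow_succ, mul_left_comm]
      refine le_mul_of_one_le_right (pow_pos (inv_pos.2 hr0) _).le ?_
      rw [← div_eq_mul_inv, one_le_div hr0]
      exact min_le_left _ _
    rw [h0, zero_sub, norm_neg, norm_mul] at h1
    have h2 : KZ.leadingMonomial m (KZ.rowReading lam)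
        (fun k : Fin lam.card => ((r⁻¹ ^ (k : ℕ) : ℝ) : ℂ)) ≠ 0 :=
      Finset.prod_ne_zero_iff.2 fun b _ => zpow_ne_zero _ (hz _)
    have h3 : 1 ≤ ‖(KZ.leadConst lam m : ℂ)‖ := by
      rw [Complex.norm_intCast]
      exact_mod_cast Int.one_le_abs (KZ.leadConst_ne_zero lam m)
    have h4 := norm_pos_iff.2 h2
    nlinarith
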